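/- Let $n\ge 1$, let $\mathbb{S}^n=\{x\in\mathbb{R}^{n+1}:|x|=1\}$ carry its surface measure $dS$, and let $L_2=L_2(\mathbb{S}^n)$ be the space of real- or complex-valued square-integrable functions. Let $\triangle^*$ be the Laplace--Beltrami operator, given on smooth functions by $\triangle^*\varphi=(\triangle\check\varphi)|_{\mathbb{S}^n}$ with $\check\varphi(x)=\varphi(x/|x|)$ and extended to a self-adjoint operator on $L_2$ by duality: $\triangle^*v=w$ if $\int\varphi\,w\,dS=\int(\triangle^*\varphi)\,v\,dS$ for all smooth $\varphi$. For $\ell\ge0$ let $\{Y_{\ell k}\}_k$ be an orthonormal basis of the space of spherical harmonics of degree $\ell$ (restrictions to $\mathbb{S}^n$ of harmonic homogeneous polynomials of degree $\ell$ on $\mathbb{R}^{n+1}$), and put $\lambda_\ell=\ell(\ell+n-1)$ and $\hat v_{\ell k}=\langle v,Y_{\ell k}\rangle$. For $\sigma\ge0$ let $H^\sigma$ be the space of all $v\in L_2$ with $$\|v\|_{H^\sigma}^2:=\sum_{\ell=0}^\infty(1+\lambda_\ell)^\sigma\sum_k|\hat v_{\ell k}|^2<\infty .$$ **Theorem.**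 For every $v\in L_2$ the heat equation $\partial_tu-\triangle^*u=0$ for $t>0$, $u(0)=v$, has a unique solution $u$ that is continuous from $[0,\infty)$ to $L_2$ and, at every $t>0$, differentiable in $L_2$ with $u(t)$ in the domain of $\triangle^*$; write $\mathcal{E}(t)v:=u(t)$. Let $0\le q\le\nu$ be real and let $m\in\{0,1,2,\dots\}$. If $v\in H^q$, then $\mathcal{E}(t)v\in H^\nu$ for all $t>0$. Moreover, for every $T>0$ there is a constant $C_T$ (depending on $T,q,\nu,m,n$, but not on $v$ or $t$) such that for all $v\in H^q$ and all $0<t\le T$, the function $s\mapsto\mathcal{E}(s)v$ is $m$ times continuously differentiable into $L_2$ near $t$, $\partial_t^m\mathcal{E}(t)v\in H^\nu$, and $$\|\partial_t^m\mathcal{E}(t)v\|_{H^\nu}\le C_T\,t^{-(\nu-q)/2-m}\,\|v\|_{H^q}.$$ -/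

import Mathlib

noncomputable section

namespace SphereHeat

open MeasureTheory MvPolynomial
open scoped ContDiff Laplacian

/-- The ambient Euclidean space `ℝ^{n+1}`. -/
abbrev Ambient (n : ℕ) : Type := EuclideanSpace ℝ (Fin (n + 1))

/-- The unit sphere `𝕊ⁿ ⊆ ℝ^{n+1}`. -/
abbrev Sphere (n : ℕ) : Type := Metric.sphere (0 : Ambient n) 1

/-- The (unnormalized) surface measure `dS` on `𝕊ⁿ`. -/
def surfaceMeasure (n : ℕ) : Measure (Sphere n) := (volume : Measure (Ambient n)).toSphere

instance (n : ℕ) : IsFiniteMeasure (surfaceMeasure n) := by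
  unfold surfaceMeasure; infer_instance

/-- The Hilbert space `L₂(𝕊ⁿ)` of `𝕜`-valued functions, `𝕜 = ℝ` or `𝕜 = ℂ`. -/
abbrev L2Sphere (𝕜 : Type*) [RCLike 𝕜] (n : ℕ) : Type _ := Lp 𝕜 2 (surfaceMeasure n)

/-! ### Spherical harmonics -/

/-- The Laplacian `∑ᵢ ∂²/∂xᵢ²` on polynomials in `n + 1` variables. -/
def polyLaplacian (𝕜 : Type*) [RCLike 𝕜] (n : ℕ) :
    MvPolynomial (Fin (n + 1)) 𝕜 →ₗ[𝕜] MvPolynomial (Fin (n + 1)) 𝕜 :=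
  ∑ i, (pderiv i).toLinearMap ∘ₗ (pderiv i).toLinearMap

/-- The homogeneous harmonic polynomials of degree `ℓ` on `ℝ^{n+1}`. -/
def harmonicPolynomials (𝕜 : Type*) [RCLike 𝕜] (n ℓ : ℕ) :
    Submodule 𝕜 (MvPolynomial (Fin (n + 1)) 𝕜) :=
  homogeneousSubmodule (Fin (n + 1)) 𝕜 ℓ ⊓ LinearMap.ker (polyLaplacian 𝕜 n)

/-- The restriction of a polynomial to the unit sphere. -/
def restrictToSphere (𝕜 : Type*) [RCLike 𝕜] (n : ℕ) :
    MvPolynomial (Fin (n + 1)) 𝕜 →ₗ[𝕜] C(Sphere n, 𝕜) where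
  toFun p :=
    { toFun := fun x => eval (fun i => (((x : Ambient n) i : ℝ) : 𝕜)) p
      continuous_toFun := by
        refine (MvPolynomial.continuous_eval p).comp (continuous_pi fun i => ?_)
        exact RCLike.continuous_ofReal.comp (by fun_prop) }
  map_add' p r := by ext x; simp
  map_smul' c p := by ext x; simp [smul_eval]

/-- The space `𝓗_ℓ` of spherical harmonics of degree `ℓ`, as a subspace of `L₂(𝕊ⁿ)`. -/
def sphericalHarmonics (𝕜 : Type*) [RCLike 𝕜] (n ℓ : ℕ) : Submodule 𝕜 (L2Sphere 𝕜 n) :=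
  (harmonicPolynomials 𝕜 n ℓ).map
    ((ContinuousMap.toLp 2 (surfaceMeasure n) 𝕜).toLinearMap ∘ₗ restrictToSphere 𝕜 n)

instance (𝕜 : Type*) [RCLike 𝕜] (n ℓ : ℕ) :
    FiniteDimensional 𝕜 (sphericalHarmonics 𝕜 n ℓ) := by
  have : FiniteDimensional 𝕜 (homogeneousSubmodule (Fin (n + 1)) 𝕜 ℓ) :=
    Module.Finite.iff_fg.2 (homogeneousSubmodule_fg (Fin (n + 1)) 𝕜 ℓ)
  have : FiniteDimensional 𝕜 (harmonicPolynomials 𝕜 n ℓ) :=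
    Submodule.finiteDimensional_of_le inf_le_left
  unfold sphericalHarmonics
  infer_instance

/-- An orthonormal basis `Y_{ℓk}` of `𝓗_ℓ`, with `k` ranging over `dim 𝓗_ℓ` indices. -/
def Y (𝕜 : Type*) [RCLike 𝕜] (n ℓ : ℕ)
    (k : Fin (Module.finrank 𝕜 (sphericalHarmonics 𝕜 n ℓ))) : L2Sphere 𝕜 n :=
  (stdOrthonormalBasis 𝕜 (sphericalHarmonics 𝕜 n ℓ) k : L2Sphere 𝕜 n)

/-- `λ_ℓ = ℓ (ℓ + n - 1)`. -/
def eigenvalue (n ℓ : ℕ) : ℝ := (ℓ : ℝ) * ((ℓ : ℝ) + (n : ℝ) - 1)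

/-! ### Sobolev spaces -/

variable {𝕜 : Type*} [RCLike 𝕜] {n : ℕ}

/-- The generalized Fourier coefficient `⟨v, Y_{ℓk}⟩` (Mathlib's inner product is conjugate-linear
in the first variable). -/
def fourierCoeff (v : L2Sphere 𝕜 n) (ℓ : ℕ)
    (k : Fin (Module.finrank 𝕜 (sphericalHarmonics 𝕜 n ℓ))) : 𝕜 :=
  inner 𝕜 (Y 𝕜 n ℓ k) v

/-- The `ℓ`-th term `(1 + λ_ℓ)^σ ∑_k |v̂_{ℓk}|²` of the squared `H^σ` norm. -/
def sobolevTerm (σ : ℝ) (v : L2Sphere 𝕜 n) (ℓ : ℕ) : ℝ :=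
  (1 + eigenvalue n ℓ) ^ σ * ∑ k, ‖fourierCoeff v ℓ k‖ ^ 2

/-- Membership of `v ∈ L₂(𝕊ⁿ)` in `H^σ(𝕊ⁿ)`: the series for the squared norm is finite.
For `σ ≥ 0` these are all the elements of `H^σ(𝕊ⁿ)`. -/
def MemSobolev (σ : ℝ) (v : L2Sphere 𝕜 n) : Prop := Summable (sobolevTerm σ v)

/-- The norm of `H^σ(𝕊ⁿ)`; meaningful on those `v` with `MemSobolev σ v`. -/
def sobolevNorm (σ : ℝ) (v : L2Sphere 𝕜 n) : ℝ := √(∑' ℓ, sobolevTerm σ v ℓ)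

/-! ### The Laplace–Beltrami operator and the heat equation -/

open Classical in
/-- The extension `φ̌(x) = φ(x / |x|)` of a function on the sphere to `ℝ^{n+1} ∖ {0}`
(with value `0` at the origin, which plays no role). -/
def radialExtension (φ : Sphere n → 𝕜) (x : Ambient n) : 𝕜 :=
  if hx : x ≠ 0 then φ ⟨‖x‖⁻¹ • x, by simp [norm_smul, norm_ne_zero_iff.2 hx]⟩ else 0

/-- Smoothness of a function on the sphere: its radial extension is smooth away from `0`. -/
def SmoothOnSphere (φ : Sphere n → 𝕜) : Prop :=
  ContDiffOn ℝ ∞ (radialExtension φ) {0}ᶜ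

/-- The Laplace–Beltrami operator `Δ*φ = (Δφ̌)|_{𝕊ⁿ}` on smooth functions. -/
def laplaceBeltrami (φ : Sphere n → 𝕜) (x : Sphere n) : 𝕜 :=
  (Δ (radialExtension φ)) (x : Ambient n)

/-- `v` lies in the domain of the self-adjoint Laplace–Beltrami operator on `L₂(𝕊ⁿ)` and
`Δ* v = w`, i.e. `∫ φ w dS = ∫ (Δ* φ) v dS` for all smooth `φ`. -/
def HasLaplaceBeltrami (v w : L2Sphere 𝕜 n) : Prop :=
  ∀ φ : Sphere n → 𝕜, SmoothOnSphere φ →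
    ∫ x, φ x * w x ∂(surfaceMeasure n) = ∫ x, laplaceBeltrami φ x * v x ∂(surfaceMeasure n)

/-- `u : [0, ∞) → L₂(𝕊ⁿ)` solves `∂ₜ u - Δ* u = 0` for `t > 0` with `u(0) = u₀`: it is continuous
on `[0, ∞)`, differentiable in `L₂` for `t > 0`, takes values in the domain of `Δ*` for `t > 0`, and
satisfies the equation there. Values at negative times are irrelevant. -/
structure IsHeatSolution (u₀ : L2Sphere 𝕜 n) (u : ℝ → L2Sphere 𝕜 n) : Prop where
  continuousOn : ContinuousOn u (Set.Ici 0)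
  initial : u 0 = u₀
  equation : ∀ t : ℝ, 0 < t → ∃ w : L2Sphere 𝕜 n, HasLaplaceBeltrami (u t) w ∧ HasDerivAt u w t

/-- The solution operator `𝓔(t)` of the homogeneous heat equation: `𝓔(t) v` is the value at time
`t ≥ 0` of the solution with initial value `v`. -/
def heatSemigroup (t : ℝ) (v : L2Sphere 𝕜 n) : L2Sphere 𝕜 n :=
  Classical.epsilon (fun u : ℝ → L2Sphere 𝕜 n => IsHeatSolution v u) t

end SphereHeat

end

/-! The spherical harmonics form a Hilbert basis of L₂ in which Δ* is diagonal with eigenvalues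
−λ_ℓ. The heat equation therefore decouples into the scalar equations y' = −λ_ℓ y, and 𝓔(t)
multiplies v̂_{ℓk} by e^{−tλ_ℓ}. The estimate reduces to bounding (1+μ)^{(ν−q)/2} μ^m e^{−tμ} by C_T
t^{−(ν−q)/2−m} uniformly in μ ≥ 0 (`exists_smoothing_bound`).

Completeness: every polynomial agrees on the sphere with a sum of harmonic ones
(`restrictToSphere_mem_iSup`), and Stone–Weierstrass makes polynomials dense.

Diagonalisation (`hasLaplaceBeltrami_iff`): harmonics are eigenfunctions by direct differentiation
of |x|^{−ℓ}p, and Δ* is symmetric by Green's identity. The latter needs no calculus on manifolds: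
for extensions Φ, Ψ homogeneous of degree zero, the field Φ∇Ψ − Ψ∇Φ is tangential to spheres, so its
divergence integrates to zero against radial cutoffs, and polar coordinates isolate the sphere
integral.

Time regularity follows from a Taylor remainder for e^{−tμ} that is uniform in μ
(`hasDerivAt_heatFlow`); uniqueness follows by solving the equation of each Fourier coefficient
(`IsHeatSolution.eq_sphereFlow`). -/

noncomputable section

namespace SphereHeat

open MeasureTheory MvPolynomial
open scoped ContDiff Laplacian

/-! ### Decomposition of polynomials into harmonic ones. -/

section Polynomials

variable {𝕜 : Type*} [RCLike 𝕜] {n : ℕ}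

/-- The polynomial `|x|² = ∑ᵢ xᵢ²`. -/
def normSqPoly (𝕜 : Type*) [RCLike 𝕜] (n : ℕ) : MvPolynomial (Fin (n + 1)) 𝕜 := ∑ i, X i ^ 2

lemma polyLaplacian_apply (p : MvPolynomial (Fin (n + 1)) 𝕜) :
    polyLaplacian 𝕜 n p = ∑ i, pderiv i (pderiv i p) := by
  simp [polyLaplacian]

lemma pderiv_normSqPoly (i : Fin (n + 1)) : pderiv i (normSqPoly 𝕜 n) = 2 * X i := by
  rw [normSqPoly, map_sum, Finset.sum_eq_single i]
  · simp
  · intro j _ hj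
    simp [pderiv_X_of_ne hj]
  · simp

lemma isHomogeneous_normSqPoly : (normSqPoly 𝕜 n).IsHomogeneous 2 :=
  IsHomogeneous.sum _ _ _ fun i _ => by simpa using (isHomogeneous_X 𝕜 i).pow 2

/-- Leibniz rule: Δ|x|² = 2(n+1), and the cross term 4 x·∇f equals 4d f by Euler's identity. -/
lemma polyLaplacian_normSqPoly_mul {d : ℕ} {f : MvPolynomial (Fin (n + 1)) 𝕜}
    (hf : f.IsHomogeneous d) :
    polyLaplacian 𝕜 n (normSqPoly 𝕜 n * f) =
      ((2 * (n + 1) + 4 * d : ℕ) : 𝕜) • f + normSqPoly 𝕜 n * polyLaplacian 𝕜 n f := by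
  have key : ∀ i, pderiv i (pderiv i (normSqPoly 𝕜 n * f)) =
      2 * f + 4 * (X i * pderiv i f) + normSqPoly 𝕜 n * pderiv i (pderiv i f) := by
    intro i
    have h2 : pderiv i (2 : MvPolynomial (Fin (n + 1)) 𝕜) = 0 := by
      exact_mod_cast (pderiv (R := 𝕜) i).map_natCast 2
    simp only [Derivation.leibniz, pderiv_normSqPoly, map_add, smul_eq_mul, pderiv_X_self, h2]
    ring
  simp only [polyLaplacian_apply, key, Finset.sum_add_distrib, ← Finset.mul_sum,
    hf.sum_X_mul_pderiv]
  simp only [Finset.sum_const, Finset.card_univ, Fintype.card_fin, nsmul_eq_mul, Nat.cast_smul_eq_nsmul]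
  push_cast
  ring

lemma exists_polyLaplacian_normSqPoly_pow_mul (j : ℕ) {d : ℕ}
    {h : MvPolynomial (Fin (n + 1)) 𝕜} (hh : h ∈ harmonicPolynomials 𝕜 n d) :
    ∃ c : ℕ, 0 < c ∧ polyLaplacian 𝕜 n (normSqPoly 𝕜 n ^ (j + 1) * h) =
      (c : 𝕜) • (normSqPoly 𝕜 n ^ j * h) := by
  obtain ⟨h1, h2⟩ := hh
  have h1 : h.IsHomogeneous d := h1
  have h2 : polyLaplacian 𝕜 n h = 0 := h2
  induction j with
  | zero =>
    refine ⟨2 * (n + 1) + 4 * d, by omega, ?_⟩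
    rw [zero_add, pow_one, polyLaplacian_normSqPoly_mul h1, h2, mul_zero, add_zero, pow_zero,
      one_mul]
  | succ j ih =>
    obtain ⟨c, hc, e⟩ := ih
    have hom : (normSqPoly 𝕜 n ^ (j + 1) * h).IsHomogeneous (2 * (j + 1) + d) :=
      (isHomogeneous_normSqPoly.pow (j + 1)).mul h1
    refine ⟨(2 * (n + 1) + 4 * (2 * (j + 1) + d)) + c, by omega, ?_⟩
    rw [pow_succ', mul_assoc, polyLaplacian_normSqPoly_mul hom, e,
      Nat.cast_add (2 * (n + 1) + 4 * (2 * (j + 1) + d)) c, add_smul, mul_smul_comm, ← mul_assoc,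
      ← pow_succ']

/-- The span of the products `|x|^{2j} h` with `h` harmonic, homogeneous of degree `k - 2j`. -/
def radialHarmonicSpan (𝕜 : Type*) [RCLike 𝕜] (n k : ℕ) :
    Submodule 𝕜 (MvPolynomial (Fin (n + 1)) 𝕜) :=
  Submodule.span 𝕜 {p | ∃ j d h, 2 * j + d = k ∧ h ∈ harmonicPolynomials 𝕜 n d ∧
    p = normSqPoly 𝕜 n ^ j * h}

lemma harmonicPolynomials_le_radialHarmonicSpan (k : ℕ) :
    harmonicPolynomials 𝕜 n k ≤ radialHarmonicSpan 𝕜 n k := fun h hh =>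
  Submodule.subset_span ⟨0, k, h, by simp, hh, by simp⟩

/-- On generators, Δ only lowers the power of |x|² by one, up to a nonzero constant that can be
divided out in characteristic zero. -/
lemma exists_polyLaplacian_eq_of_mem_radialHarmonicSpan {k : ℕ}
    {p : MvPolynomial (Fin (n + 1)) 𝕜} (hp : p ∈ radialHarmonicSpan 𝕜 n k) :
    ∃ r ∈ radialHarmonicSpan 𝕜 n (k + 2), polyLaplacian 𝕜 n r = p := by
  induction hp using Submodule.span_induction with
  | mem p hp =>
    obtain ⟨j, d, h, hk, hh, rfl⟩ := hp
    obtain ⟨c, hc, e⟩ := exists_polyLaplacian_normSqPoly_pow_mul j hh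
    refine ⟨(c : 𝕜)⁻¹ • (normSqPoly 𝕜 n ^ (j + 1) * h), Submodule.smul_mem _ _
      (Submodule.subset_span ⟨j + 1, d, h, by omega, hh, rfl⟩), ?_⟩
    rw [map_smul, e, smul_smul, inv_mul_cancel₀ (by exact_mod_cast hc.ne'), one_smul]
  | zero => exact ⟨0, zero_mem _, map_zero _⟩
  | add x y _ _ hx hy =>
    obtain ⟨a, ha, rfl⟩ := hx
    obtain ⟨b, hb, rfl⟩ := hy
    exact ⟨a + b, add_mem ha hb, map_add _ _ _⟩
  | smul c x _ hx =>
    obtain ⟨a, ha, rfl⟩ := hx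
    exact ⟨c • a, Submodule.smul_mem _ _ ha, map_smul _ _ _⟩

lemma isHomogeneous_radialHarmonicSpan (k : ℕ) :
    radialHarmonicSpan 𝕜 n k ≤ homogeneousSubmodule (Fin (n + 1)) 𝕜 k := by
  refine Submodule.span_le.2 ?_
  rintro _ ⟨j, d, h, rfl, hh, rfl⟩
  exact (isHomogeneous_normSqPoly.pow j).mul hh.1

lemma pderiv_eq_zero_of_isHomogeneous_zero {p : MvPolynomial (Fin (n + 1)) 𝕜}
    (hp : p.IsHomogeneous 0) (i : Fin (n + 1)) : pderiv i p = 0 := by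
  rw [totalDegree_eq_zero_iff_eq_C.1 (Nat.le_zero.1 hp.totalDegree_le), pderiv_C]

/-- Every homogeneous polynomial of degree `k` is a sum of products `|x|^{2j} h` with `h` harmonic
and homogeneous of degree `k - 2j`. -/
lemma homogeneousSubmodule_le_radialHarmonicSpan (k : ℕ) :
    homogeneousSubmodule (Fin (n + 1)) 𝕜 k ≤ radialHarmonicSpan 𝕜 n k := by
  induction k using Nat.twoStepInduction with
  | zero =>
    intro p hp
    refine harmonicPolynomials_le_radialHarmonicSpan 0 ⟨hp, ?_⟩
    simp [polyLaplacian_apply, pderiv_eq_zero_of_isHomogeneous_zero hp]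
  | one =>
    intro p hp
    refine harmonicPolynomials_le_radialHarmonicSpan 1 ⟨hp, ?_⟩
    have hp : p.IsHomogeneous 1 := hp
    change polyLaplacian 𝕜 n p = 0
    rw [polyLaplacian_apply]
    exact Finset.sum_eq_zero fun i _ => pderiv_eq_zero_of_isHomogeneous_zero hp.pderiv i
  | more k ih _ =>
    intro p hp
    have hp : p.IsHomogeneous (k + 2) := hp
    have hΔ : polyLaplacian 𝕜 n p ∈ homogeneousSubmodule (Fin (n + 1)) 𝕜 k := by
      rw [polyLaplacian_apply]
      exact Submodule.sum_mem _ fun i _ => (hp.pderiv (i := i)).pderiv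
    -- Induction applies to Δp; correcting p by a preimage r of Δp leaves a harmonic remainder.
    obtain ⟨r, hr, e⟩ := exists_polyLaplacian_eq_of_mem_radialHarmonicSpan (ih hΔ)
    have hpr : p - r ∈ harmonicPolynomials 𝕜 n (k + 2) :=
      ⟨Submodule.sub_mem _ hp (isHomogeneous_radialHarmonicSpan _ hr), by simp [e]⟩
    simpa using add_mem (harmonicPolynomials_le_radialHarmonicSpan _ hpr) hr

lemma eval_normSqPoly_sphere (x : Sphere n) :
    eval (fun i => (((x : Ambient n) i : ℝ) : 𝕜)) (normSqPoly 𝕜 n) = 1 := by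
  have h : ∑ i, ((x : Ambient n) i) ^ 2 = 1 := by
    rw [← EuclideanSpace.real_norm_sq_eq, norm_eq_of_mem_sphere x, one_pow]
  simp only [normSqPoly, map_sum, map_pow, eval_X]
  exact_mod_cast congrArg (fun r : ℝ => (r : 𝕜)) h

/-- The restriction of any polynomial to the sphere is a sum of restrictions of homogeneous
harmonic polynomials. -/
lemma restrictToSphere_mem_iSup (p : MvPolynomial (Fin (n + 1)) 𝕜) :
    restrictToSphere 𝕜 n p ∈ ⨆ ℓ, (harmonicPolynomials 𝕜 n ℓ).map (restrictToSphere 𝕜 n) := by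
  suffices H : ∀ k, (radialHarmonicSpan 𝕜 n k).map (restrictToSphere 𝕜 n) ≤
      ⨆ ℓ, (harmonicPolynomials 𝕜 n ℓ).map (restrictToSphere 𝕜 n) by
    rw [← sum_homogeneousComponent p, map_sum]
    exact Submodule.sum_mem _ fun k _ => H k (Submodule.mem_map_of_mem
      (homogeneousSubmodule_le_radialHarmonicSpan k (homogeneousComponent_isHomogeneous k p)))
  intro k
  rw [radialHarmonicSpan, Submodule.map_span, Submodule.span_le]
  rintro _ ⟨_, ⟨j, d, h, rfl, hh, rfl⟩, rfl⟩
  refine Submodule.mem_iSup_of_mem d ⟨h, hh, ?_⟩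
  ext x
  simp [restrictToSphere, eval_normSqPoly_sphere]

end Polynomials

/-! ### Diagonal heat semigroups in a Hilbert space. -/

section DiagonalSemigroup

open Filter Topology

variable {ι 𝕜 H : Type*} [RCLike 𝕜] [NormedAddCommGroup H] [InnerProductSpace 𝕜 H]

lemma hasSum_norm_sq_repr (b : HilbertBasis ι 𝕜 H) (v : H) :
    HasSum (fun i => ‖b.repr v i‖ ^ 2) (‖v‖ ^ 2) := by
  have h := lp.hasSum_norm (p := 2) (by norm_num) (b.repr v)
  simpa using h

lemma norm_le_of_norm_repr_le (b : HilbertBasis ι 𝕜 H) {v w : H} {K : ℝ} (hK : 0 ≤ K)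
    (h : ∀ i, ‖b.repr w i‖ ≤ K * ‖b.repr v i‖) : ‖w‖ ≤ K * ‖v‖ := by
  refine le_of_sq_le_sq ?_ (by positivity)
  rw [mul_pow]
  refine hasSum_le (fun i => ?_) (hasSum_norm_sq_repr b w)
    ((hasSum_norm_sq_repr b v).mul_left (K ^ 2))
  rw [← mul_pow]
  exact pow_le_pow_left₀ (norm_nonneg _) (h i) 2

open Classical in
/-- The diagonal operator with multipliers `c i` in the Hilbert basis `b`. -/
def diagonal (b : HilbertBasis ι 𝕜 H) (c : ι → ℝ) (v : H) : H :=
  if h : Memℓp (fun i => (c i : 𝕜) * b.repr v i) 2 then b.repr.symm ⟨_, h⟩ else 0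

lemma repr_diagonal (b : HilbertBasis ι 𝕜 H) {c : ι → ℝ} {K : ℝ} (hc : ∀ i, |c i| ≤ K) (v : H)
    (i : ι) : b.repr (diagonal b c v) i = (c i : 𝕜) * b.repr v i := by
  have h : Memℓp (fun i => (c i : 𝕜) * b.repr v i) 2 := by
    refine memℓp_gen ?_
    refine Summable.of_nonneg_of_le (fun i => by positivity) (fun i => ?_)
      ((hasSum_norm_sq_repr b v).summable.mul_left (K ^ 2))
    simp only [ENNReal.toReal_ofNat, Real.rpow_ofNat, norm_mul, RCLike.norm_ofReal, mul_pow]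
    gcongr
    exact hc i
  rw [diagonal, dif_pos h, LinearIsometryEquiv.apply_symm_apply]

lemma pow_mul_exp_neg_mul_le (k : ℕ) {t μ : ℝ} (ht : 0 < t) (hμ : 0 ≤ μ) :
    μ ^ k * Real.exp (-(t * μ)) ≤ k.factorial / t ^ k := by
  have h := Real.pow_div_factorial_le_exp (t * μ) (by positivity) k
  rw [div_le_iff₀ (by positivity), mul_pow] at h
  rw [le_div_iff₀ (by positivity), Real.exp_neg, ← div_eq_mul_inv, div_mul_eq_mul_div,
    div_le_iff₀ (Real.exp_pos _)]
  linarith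

/-- The `k`-th time derivative of `e^{-tμ}`. -/
def expMultiplier (k : ℕ) (t μ : ℝ) : ℝ := (-μ) ^ k * Real.exp (-(t * μ))

lemma hasDerivAt_expMultiplier (k : ℕ) (t μ : ℝ) :
    HasDerivAt (fun s => expMultiplier k s μ) (expMultiplier (k + 1) t μ) t := by
  have h := (((hasDerivAt_id t).mul_const μ).neg.exp).const_mul ((-μ) ^ k)
  refine h.congr_deriv ?_
  simp [expMultiplier]
  ring

lemma abs_expMultiplier_le (k : ℕ) {s t μ : ℝ} (ht : 0 < t) (hst : t ≤ s) (hμ : 0 ≤ μ) :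
    |expMultiplier k s μ| ≤ k.factorial / t ^ k := by
  rw [expMultiplier, abs_mul, abs_pow, abs_neg, abs_of_nonneg hμ, Real.abs_exp]
  refine (pow_mul_exp_neg_mul_le k (ht.trans_le hst) hμ).trans ?_
  gcongr

/-- The mean value inequality is used twice. Staying at times ≥ t/2 bounds the second time
derivative by a constant independent of μ; this uniformity is what allows differentiation of the
whole series in norm. -/
lemma abs_expMultiplier_taylor_le (k : ℕ) {s t μ : ℝ} (ht : 0 < t) (hs : t / 2 ≤ s)
    (hμ : 0 ≤ μ) :
    |expMultiplier k s μ - expMultiplier k t μ - (s - t) * expMultiplier (k + 1) t μ| ≤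
      (k + 2).factorial / (t / 2) ^ (k + 2) * (s - t) ^ 2 := by
  set K : ℝ := (k + 2).factorial / (t / 2) ^ (k + 2)
  have h1 : ∀ r ∈ Set.uIcc t s, |expMultiplier (k + 1) r μ - expMultiplier (k + 1) t μ| ≤
      K * |s - t| := by
    intro r hr
    have hsub : ∀ x ∈ Set.uIcc t s, t / 2 ≤ x := fun x hx =>
      (le_min (by linarith) hs).trans hx.1
    have := Convex.norm_image_sub_le_of_norm_hasDerivWithin_le (C := K)
      (fun x _ => (hasDerivAt_expMultiplier (k + 1) x μ).hasDerivWithinAt)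
      (fun x hx => abs_expMultiplier_le (k + 2) (by linarith) (hsub x hx) hμ) (convex_uIcc t s)
      Set.left_mem_uIcc hr
    refine this.trans ?_
    have : |r - t| ≤ |s - t| := Set.abs_sub_left_of_mem_uIcc hr
    rw [Real.norm_eq_abs]
    gcongr
  have h2 := Convex.norm_image_sub_le_of_norm_hasDerivWithin_le (C := K * |s - t|)
      (f := fun r => expMultiplier k r μ - r * expMultiplier (k + 1) t μ)
      (fun x _ => ((hasDerivAt_expMultiplier k x μ).sub
        ((hasDerivAt_id x).mul_const (expMultiplier (k + 1) t μ))).hasDerivWithinAt)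
      (fun x hx => by simpa using h1 x hx) (convex_uIcc t s)
      Set.left_mem_uIcc Set.right_mem_uIcc
  rw [Real.norm_eq_abs, Real.norm_eq_abs, mul_assoc, abs_mul_abs_self, ← sq] at h2
  convert h2 using 2
  ring

/-- The `k`-th time derivative at `t` of `∑ᵢ e^{-t μᵢ} ⟨bᵢ, v⟩ bᵢ`. -/
def heatFlow (b : HilbertBasis ι 𝕜 H) (μ : ι → ℝ) (v : H) (k : ℕ) (t : ℝ) : H :=
  diagonal b (fun i => expMultiplier k t (μ i)) v

variable (b : HilbertBasis ι 𝕜 H) {μ : ι → ℝ} (hμ : ∀ i, 0 ≤ μ i) (v : H)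

include hμ

lemma repr_heatFlow (k : ℕ) {t : ℝ} (ht : 0 < t) (i : ι) :
    b.repr (heatFlow b μ v k t) i = (expMultiplier k t (μ i) : 𝕜) * b.repr v i :=
  repr_diagonal b (fun i => abs_expMultiplier_le k ht le_rfl (hμ i)) v i

lemma abs_expMultiplier_zero_le {t : ℝ} (ht : 0 ≤ t) (i : ι) : |expMultiplier 0 t (μ i)| ≤ 1 := by
  rw [expMultiplier, pow_zero, one_mul, Real.abs_exp, Real.exp_le_one_iff]
  have := mul_nonneg ht (hμ i)
  linarith

lemma repr_heatFlow_zero {t : ℝ} (ht : 0 ≤ t) (i : ι) :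
    b.repr (heatFlow b μ v 0 t) i = (expMultiplier 0 t (μ i) : 𝕜) * b.repr v i :=
  repr_diagonal b (abs_expMultiplier_zero_le hμ ht) v i

lemma heatFlow_zero_zero : heatFlow b μ v 0 0 = v := by
  apply b.repr.injective
  ext i
  rw [repr_heatFlow_zero b hμ v le_rfl]
  simp [expMultiplier]

/-- At time 0 the multipliers are not equicontinuous for unbounded μ, so uniform estimates give way
to dominated convergence in Parseval's sum. The factor 2² arises because two multipliers of size at
most 1 are subtracted. -/
lemma continuousOn_heatFlow_zero : ContinuousOn (heatFlow b μ v 0) (Set.Ici 0) := by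
  intro t₀ ht₀
  rw [ContinuousWithinAt, tendsto_iff_norm_sub_tendsto_zero]
  have hsq : Tendsto (fun t => ‖heatFlow b μ v 0 t - heatFlow b μ v 0 t₀‖ ^ 2)
      (𝓝[Set.Ici 0] t₀) (𝓝 0) := by
    have h : Tendsto (fun t => ∑' i, ‖((expMultiplier 0 t (μ i) - expMultiplier 0 t₀ (μ i) : ℝ) : 𝕜)
        * b.repr v i‖ ^ 2) (𝓝[Set.Ici 0] t₀) (𝓝 (∑' _ : ι, 0)) := by
      refine tendsto_tsum_of_dominated_convergence
        ((hasSum_norm_sq_repr b v).summable.mul_left (2 ^ 2)) (fun i => ?_) ?_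
      · have hc : Continuous (fun t => ‖((expMultiplier 0 t (μ i) - expMultiplier 0 t₀ (μ i) : ℝ)
            : 𝕜) * b.repr v i‖ ^ 2) := by
          simp only [expMultiplier]
          fun_prop
        simpa using (hc.tendsto t₀).mono_left nhdsWithin_le_nhds
      · filter_upwards [self_mem_nhdsWithin] with t ht i
        rw [Real.norm_eq_abs, abs_of_nonneg (by positivity), norm_mul, mul_pow, RCLike.norm_ofReal]
        gcongr
        refine (abs_sub _ _).trans ?_
        linarith [abs_expMultiplier_zero_le hμ ht i, abs_expMultiplier_zero_le hμ ht₀ i]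
    rw [tsum_zero] at h
    refine h.congr' ?_
    filter_upwards [self_mem_nhdsWithin] with t ht
    rw [← (hasSum_norm_sq_repr b _).tsum_eq]
    congr 1
    ext i
    rw [map_sub, lp.coeFn_sub, Pi.sub_apply, repr_heatFlow_zero b hμ v ht,
      repr_heatFlow_zero b hμ v ht₀, ← sub_mul]
    push_cast
    rfl
  have := hsq.sqrt
  simpa [Real.sqrt_sq (norm_nonneg _)] using this

variable [NormedSpace ℝ H] [IsScalarTower ℝ 𝕜 H]

lemma hasDerivAt_heatFlow (k : ℕ) {t : ℝ} (ht : 0 < t) :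
    HasDerivAt (heatFlow b μ v k) (heatFlow b μ v (k + 1) t) t := by
  rw [hasDerivAt_iff_isLittleO]
  set K : ℝ := (k + 2).factorial / (t / 2) ^ (k + 2)
  have hO : (fun s => heatFlow b μ v k s - heatFlow b μ v k t - (s - t) • heatFlow b μ v (k + 1) t)
      =O[𝓝 t] fun s => (s - t) ^ 2 := by
    refine Asymptotics.IsBigO.of_bound (K * ‖v‖) ?_
    filter_upwards [lt_mem_nhds (show t / 2 < t by linarith)] with s hs
    have := norm_le_of_norm_repr_le b (v := v) (K := K * (s - t) ^ 2)
      (w := heatFlow b μ v k s - heatFlow b μ v k t - (s - t) • heatFlow b μ v (k + 1) t)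
      (by positivity) (fun i => ?_)
    · refine this.trans_eq ?_
      rw [Real.norm_eq_abs, abs_of_nonneg (sq_nonneg _)]
      ring
    · rw [RCLike.real_smul_eq_coe_smul (K := 𝕜) (s - t), map_sub, map_sub, map_smul,
        lp.coeFn_sub, Pi.sub_apply, lp.coeFn_sub, Pi.sub_apply, lp.coeFn_smul, Pi.smul_apply,
        repr_heatFlow b hμ v k ht, repr_heatFlow b hμ v (k + 1) ht,
        repr_heatFlow b hμ v k (by linarith : 0 < s), smul_eq_mul, ← mul_assoc, ← sub_mul,
        ← sub_mul, norm_mul]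
      gcongr
      have h := abs_expMultiplier_taylor_le k ht hs.le (hμ i)
      rw [← RCLike.norm_ofReal (K := 𝕜)] at h
      push_cast at h ⊢
      exact h
  refine hO.trans_isLittleO ?_
  have h1 : Tendsto (fun s => s - t) (𝓝 t) (𝓝 0) := by
    simpa using (continuous_sub_right t).tendsto t
  have := (Asymptotics.isLittleO_pow_id (𝕜 := ℝ) one_lt_two).comp_tendsto h1
  exact this

lemma contDiffOn_heatFlow (m k : ℕ) : ContDiffOn ℝ m (heatFlow b μ v k) (Set.Ioi 0) := by
  induction m generalizing k with
  | zero =>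
    exact contDiffOn_zero.2 fun t ht => (hasDerivAt_heatFlow b hμ v k ht).continuousAt.continuousWithinAt
  | succ m ih =>
    rw [show ((m + 1 : ℕ) : WithTop ℕ∞) = (m : WithTop ℕ∞) + 1 by push_cast; rfl,
      contDiffOn_succ_iff_deriv_of_isOpen isOpen_Ioi]
    refine ⟨fun t ht => (hasDerivAt_heatFlow b hμ v k ht).differentiableAt.differentiableWithinAt,
      by simp, (ih (k + 1)).congr fun t ht => (hasDerivAt_heatFlow b hμ v k ht).deriv⟩

/-- Agreement on positive times suffices, so the uncontrolled values of a solution at negative times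
do no harm. -/
lemma iteratedDeriv_heatFlow {u : ℝ → H} (hu : ∀ t, 0 < t → u t = heatFlow b μ v 0 t) (m : ℕ)
    {t : ℝ} (ht : 0 < t) : iteratedDeriv m u t = heatFlow b μ v m t := by
  induction m generalizing t with
  | zero => rw [iteratedDeriv_zero, hu t ht]
  | succ m ih =>
    rw [iteratedDeriv_succ]
    have : iteratedDeriv m u =ᶠ[𝓝 t] heatFlow b μ v m := by
      filter_upwards [lt_mem_nhds ht] with s hs using ih hs
    rw [this.deriv_eq, (hasDerivAt_heatFlow b hμ v m ht).deriv]

end DiagonalSemigroup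

/-! ### Green's identity on the sphere via the ambient space. -/

section Green

open Filter Topology

variable {𝕜 : Type*} [RCLike 𝕜] {n : ℕ}

lemma two_le_infty : (2 : WithTop ℕ∞) ≤ ∞ := by
  simpa using WithTop.coe_le_coe.2 (le_top : (2 : ℕ∞) ≤ ⊤)

/-- The partial derivative `∂f/∂xᵢ`. -/
def partialDeriv (i : Fin (n + 1)) (f : Ambient n → 𝕜) (x : Ambient n) : 𝕜 :=
  fderiv ℝ f x (EuclideanSpace.basisFun (Fin (n + 1)) ℝ i)

lemma laplacian_eq_sum_partialDeriv {f : Ambient n → 𝕜} {x : Ambient n}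
    (hf : ContDiffAt ℝ 2 f x) : (Δ f) x = ∑ i, partialDeriv i (partialDeriv i f) x := by
  rw [InnerProductSpace.laplacian_eq_iteratedFDeriv_orthonormalBasis f
    (EuclideanSpace.basisFun (Fin (n + 1)) ℝ)]
  refine Finset.sum_congr rfl fun i _ => ?_
  have hd : DifferentiableAt ℝ (fderiv ℝ f) x :=
    (hf.fderiv_right (m := 1) (by norm_num)).differentiableAt (by norm_num)
  rw [iteratedFDeriv_two_apply, partialDeriv]
  change _ = fderiv ℝ (fun y => fderiv ℝ f y _) x _
  rw [fderiv_clm_apply hd (differentiableAt_const _)]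
  simp

/-- Chain rule, twice. Applied to radial extensions it shows that their Laplacian is homogeneous of
degree −2. -/
lemma laplacian_smul_of_invariant {f : Ambient n → 𝕜} {c : ℝ} (hf : ∀ x, f (c • x) = f x)
    (x : Ambient n) : (Δ f) x = c ^ 2 • (Δ f) (c • x) := by
  have h1 : fderiv ℝ f = fun x => c • fderiv ℝ f (c • x) := by
    ext1 x
    rw [← fderiv_comp_smul]
    simp only [hf]
  have h2 : fderiv ℝ (fderiv ℝ f) x = c • c • fderiv ℝ (fderiv ℝ f) (c • x) := by
    conv_lhs => rw [h1]
    have := congrFun (fderiv_const_smul_field (𝕜 := ℝ) (f := fun x => fderiv ℝ f (c • x)) c) x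
    rw [Pi.smul_apply, fderiv_comp_smul] at this
    exact this
  simp only [InnerProductSpace.laplacian_eq_iteratedFDeriv_orthonormalBasis f
    (EuclideanSpace.basisFun (Fin (n + 1)) ℝ), iteratedFDeriv_two_apply, h2, Finset.smul_sum]
  refine Finset.sum_congr rfl fun i _ => ?_
  simp only [smul_apply, smul_smul, sq]

lemma radialExtension_of_ne_zero (φ : Sphere n → 𝕜) {x : Ambient n} (hx : x ≠ 0) :
    radialExtension φ x =
      φ ⟨‖x‖⁻¹ • x, by simp [norm_smul, norm_ne_zero_iff.2 hx]⟩ := by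
  rw [radialExtension, dif_pos hx]

lemma coe_sphere_ne_zero (x : Sphere n) : (x : Ambient n) ≠ 0 :=
  ne_zero_of_mem_unit_sphere x

lemma radialExtension_coe (φ : Sphere n → 𝕜) (x : Sphere n) : radialExtension φ x = φ x := by
  rw [radialExtension_of_ne_zero φ (coe_sphere_ne_zero x)]
  congr 1
  ext1
  simp

lemma radialExtension_smul (φ : Sphere n → 𝕜) {c : ℝ} (hc : 0 < c) (x : Ambient n) :
    radialExtension φ (c • x) = radialExtension φ x := by
  by_cases hx : x = 0
  · simp [hx]
  rw [radialExtension_of_ne_zero φ hx, radialExtension_of_ne_zero φ (smul_ne_zero hc.ne' hx)]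
  congr 2
  rw [norm_smul, Real.norm_of_nonneg hc.le, smul_smul, mul_inv, mul_right_comm,
    inv_mul_cancel₀ hc.ne', one_mul]

lemma laplacian_radialExtension (φ : Sphere n → 𝕜) {x : Ambient n} (hx : x ≠ 0) :
    (Δ (radialExtension φ)) x = (‖x‖ ^ 2)⁻¹ • radialExtension (laplaceBeltrami φ) x := by
  rw [radialExtension_of_ne_zero _ hx, laplaceBeltrami, ← inv_pow,
    ← laplacian_smul_of_invariant (radialExtension_smul φ (by positivity))]

lemma SmoothOnSphere.contDiffAt {φ : Sphere n → 𝕜} (hφ : SmoothOnSphere φ) {x : Ambient n}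
    (hx : x ≠ 0) : ContDiffAt ℝ ∞ (radialExtension φ) x :=
  ContDiffOn.contDiffAt hφ (isOpen_compl_singleton.mem_nhds hx)

lemma SmoothOnSphere.continuous {φ : Sphere n → 𝕜} (hφ : SmoothOnSphere φ) : Continuous φ := by
  have h : Continuous fun x : Sphere n => radialExtension φ x :=
    (ContDiffOn.continuousOn hφ).comp_continuous continuous_subtype_val coe_sphere_ne_zero
  simpa only [radialExtension_coe] using h

lemma contDiffOn_partialDeriv {f : Ambient n → 𝕜} (hf : ContDiffOn ℝ ∞ f {0}ᶜ)
    (i : Fin (n + 1)) : ContDiffOn ℝ ∞ (partialDeriv i f) {0}ᶜ :=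
  (hf.fderiv_of_isOpen (m := ∞) isOpen_compl_singleton (by simp)).clm_apply contDiffOn_const

lemma SmoothOnSphere.continuous_laplaceBeltrami {φ : Sphere n → 𝕜} (hφ : SmoothOnSphere φ) :
    Continuous (laplaceBeltrami φ) := by
  have h : ContinuousOn (fun x => ∑ i, partialDeriv i (partialDeriv i (radialExtension φ)) x)
      {0}ᶜ := continuousOn_finsetSum _ fun i _ =>
    (contDiffOn_partialDeriv (contDiffOn_partialDeriv hφ i) i).continuousOn
  have h' := h.comp_continuous (f := fun x : Sphere n => (x : Ambient n)) continuous_subtype_val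
    coe_sphere_ne_zero
  refine h'.congr fun x => ?_
  rw [laplaceBeltrami, laplacian_eq_sum_partialDeriv
    ((hφ.contDiffAt (coe_sphere_ne_zero x)).of_le two_le_infty)]
  rfl

lemma fderiv_apply_eq_sum (f : Ambient n → 𝕜) (x y : Ambient n) :
    fderiv ℝ f x y = ∑ i, y i • partialDeriv i f x := by
  conv_lhs => rw [← (EuclideanSpace.basisFun (Fin (n + 1)) ℝ).sum_repr y, map_sum]
  simp [partialDeriv]

/-- Euler's identity for the radial extension, which is homogeneous of degree zero. -/
lemma sum_smul_partialDeriv_radialExtension {φ : Sphere n → 𝕜} (hφ : SmoothOnSphere φ)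
    {x : Ambient n} (hx : x ≠ 0) :
    ∑ i, x i • partialDeriv i (radialExtension φ) x = 0 := by
  rw [← fderiv_apply_eq_sum]
  have hd : HasFDerivAt (radialExtension φ) (fderiv ℝ (radialExtension φ) x) ((1 : ℝ) • x) := by
    rw [one_smul]
    exact ((hφ.contDiffAt hx).differentiableAt (by simp)).hasFDerivAt
  have h1 : HasDerivAt (fun c : ℝ => radialExtension φ (c • x))
      (fderiv ℝ (radialExtension φ) x x) 1 := by
    have := hd.comp_hasDerivAt (1 : ℝ) ((hasDerivAt_id (1 : ℝ)).smul_const x)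
    simp only [one_smul] at this
    exact this
  have h2 : HasDerivAt (fun c : ℝ => radialExtension φ (c • x)) 0 1 := by
    refine (hasDerivAt_const (1 : ℝ) (radialExtension φ x)).congr_of_eventuallyEq ?_
    filter_upwards [lt_mem_nhds one_pos] with c hc using radialExtension_smul φ hc x
  exact h1.unique h2

/-- Integration in polar coordinates of a product of a radial function and a function that is
homogeneous of degree zero. -/
lemma integral_norm_mul_radialExtension (h : ℝ → ℝ) (g : Sphere n → 𝕜) :
    ∫ x : Ambient n, (h ‖x‖ : 𝕜) * radialExtension g x =
      (∫ x, g x ∂(surfaceMeasure n)) *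
        ∫ r : Set.Ioi (0 : ℝ), (h r : 𝕜) ∂(Measure.volumeIoiPow n) := by
  have hdim : Module.finrank ℝ (Ambient n) - 1 = n := by simp
  have hmp := (volume : Measure (Ambient n)).measurePreserving_homeomorphUnitSphereProd
  rw [hdim] at hmp
  calc ∫ x : Ambient n, (h ‖x‖ : 𝕜) * radialExtension g x
      = ∫ x : ({(0)}ᶜ : Set (Ambient n)), (h ‖x.1‖ : 𝕜) * radialExtension g x.1
          ∂((volume : Measure (Ambient n)).comap (↑)) := by
        rw [integral_subtype_comap (measurableSet_singleton _).compl
          fun x : Ambient n => (h ‖x‖ : 𝕜) * radialExtension g x, restrict_compl_singleton]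
    _ = ∫ z, g z.1 * (h z.2 : 𝕜) ∂((surfaceMeasure n).prod (.volumeIoiPow n)) := by
        rw [surfaceMeasure, ← hmp.integral_comp (Homeomorph.measurableEmbedding _)
          (fun z => g z.1 * (h z.2 : 𝕜))]
        refine integral_congr_ae (ae_of_all _ fun x => ?_)
        have hx : (x : Ambient n) ≠ 0 := x.2
        simp only
        rw [radialExtension_of_ne_zero g hx, mul_comm, homeomorphUnitSphereProd_apply_snd_coe]
        congr 2
        ext1
        simp
    _ = _ := integral_prod_mul g fun r : Set.Ioi (0 : ℝ) => (h r : 𝕜)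

/-- `g` may be singular at the origin; the cutoff vanishes near it, so the product is continuous
with compact support. -/
lemma integrable_smul_of_tsupport_subset {f : Ambient n → ℝ} (hf : Continuous f) (hfc : HasCompactSupport f)
    (hfs : tsupport f ⊆ {0}ᶜ) {g : Ambient n → 𝕜} (hg : ContinuousOn g {0}ᶜ) :
    Integrable (fun x => f x • g x) := by
  refine Continuous.integrable_of_hasCompactSupport ?_ hfc.smul_right
  refine continuous_of_tsupport fun x hx => ?_
  exact hf.continuousAt.smul (hg.continuousAt (isOpen_compl_singleton.mem_nhds
    (hfs (closure_mono (Function.support_smul_subset_left f g) hx))))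

/-- A cutoff function in the variable `‖x‖²`. -/
structure IsRadialCutoff (η : ℝ → ℝ) : Prop where
  contDiff : ContDiff ℝ ∞ η
  hasCompactSupport : HasCompactSupport η
  tsupport_subset : tsupport η ⊆ Set.Ioi 0

namespace IsRadialCutoff

variable {η : ℝ → ℝ} (hη : IsRadialCutoff η)
include hη

lemma contDiff_norm_sq : ContDiff ℝ ∞ fun x : Ambient n => η (‖x‖ ^ 2) :=
  hη.contDiff.comp (_root_.contDiff_norm_sq ℝ)

lemma tsupport_norm_sq_subset :
    tsupport (fun x : Ambient n => η (‖x‖ ^ 2)) ⊆ {0}ᶜ := by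
  intro x hx
  have := hη.tsupport_subset (tsupport_comp_subset_preimage (f := fun x : Ambient n => ‖x‖ ^ 2) η
    (by fun_prop) hx)
  rintro rfl
  simp at this

lemma hasCompactSupport_norm_sq : HasCompactSupport fun x : Ambient n => η (‖x‖ ^ 2) := by
  obtain ⟨M, hM⟩ := hη.hasCompactSupport.isCompact.bddAbove
  refine HasCompactSupport.intro (isCompact_closedBall (0 : Ambient n) (M + 1)) fun x hx => ?_
  refine image_eq_zero_of_notMem_tsupport fun h => hx ?_
  have := hM h
  rw [mem_closedBall_zero_iff]
  -- 2‖x‖ ≤ ‖x‖² + 1 ≤ M + 1.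
  nlinarith [norm_nonneg x, sq_nonneg (‖x‖ - 1)]

/-- A vector field that is tangential to all spheres integrates by parts against radial functions
without a boundary term. -/
lemma integral_smul_divergence_eq_zero {G : Fin (n + 1) → Ambient n → 𝕜}
    (hG : ∀ i, ContDiffOn ℝ ∞ (G i) {0}ᶜ) (hG0 : ∀ x, x ≠ 0 → ∑ i, x i • G i x = 0) :
    ∫ x : Ambient n, η (‖x‖ ^ 2) • ∑ i, partialDeriv i (G i) x = 0 := by
  set χ : Ambient n → ℝ := fun x => η (‖x‖ ^ 2) with hχ
  have hχd : ContDiff ℝ ∞ χ := hη.contDiff_norm_sq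
  have hχs : tsupport χ ⊆ {0}ᶜ := hη.tsupport_norm_sq_subset
  have hχc : HasCompactSupport χ := hη.hasCompactSupport_norm_sq
  let e : Fin (n + 1) → Ambient n := fun i => EuclideanSpace.basisFun (Fin (n + 1)) ℝ i
  -- The gradient of `χ` is a multiple of x, hence orthogonal to the tangential field `G`; this
  -- kills the integrand after integration by parts.
  have hfd : ∀ x y, fderiv ℝ χ x y = 2 * deriv η (‖x‖ ^ 2) * inner ℝ x y := by
    intro x y
    have h1 := ((hη.contDiff.differentiable (by simp)) (‖x‖ ^ 2)).hasDerivAt.comp_hasFDerivAt x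
      (hasStrictFDerivAt_norm_sq x).hasFDerivAt
    rw [show χ = η ∘ fun x : Ambient n => ‖x‖ ^ 2 from rfl, h1.fderiv]
    simp
    ring
  have hint1 : ∀ i, Integrable fun x => χ x • partialDeriv i (G i) x := fun i =>
    integrable_smul_of_tsupport_subset hχd.continuous hχc hχs (contDiffOn_partialDeriv (hG i) i).continuousOn
  have hint2 : ∀ i, Integrable fun x => fderiv ℝ χ x (e i) • G i x := fun i =>
    integrable_smul_of_tsupport_subset ((hχd.continuous_fderiv (by simp)).clm_apply continuous_const)
      (hχc.fderiv_apply (𝕜 := ℝ) (e i))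
      ((tsupport_fderiv_apply_subset ℝ (e i)).trans hχs) (hG i).continuousOn
  have hparts : ∀ i, ∫ x, χ x • partialDeriv i (G i) x = -∫ x, fderiv ℝ χ x (e i) • G i x :=
    fun i => integral_smul_fderiv_eq_neg_fderiv_smul_of_integrable (hint2 i) (hint1 i)
      (integrable_smul_of_tsupport_subset hχd.continuous hχc hχs (hG i).continuousOn)
      (fun x _ => hχd.differentiable (by simp) x)
      (fun x hx => ((hG i).contDiffAt (isOpen_compl_singleton.mem_nhds (hχs hx))).differentiableAt
        (by simp))
  simp only [Finset.smul_sum]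
  rw [integral_finsetSum _ fun i _ => hint1 i]
  simp only [hparts]
  rw [Finset.sum_neg_distrib, ← integral_finsetSum _ fun i _ => hint2 i, neg_eq_zero]
  refine integral_eq_zero_of_ae (ae_of_all _ fun x => ?_)
  by_cases hx : x = 0
  · simp [hfd, hx]
  · have h := hG0 x hx
    have h' : ∀ i, fderiv ℝ χ x (e i) • G i x =
        (2 * deriv η (‖x‖ ^ 2)) • (x i • G i x) := by
      intro i
      rw [hfd, smul_smul]
      simp [e, EuclideanSpace.inner_single_right]
    simp only [h', ← Finset.smul_sum, h, smul_zero, Pi.zero_apply]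

end IsRadialCutoff

/-- The products of first derivatives cancel, so summing over i gives fΔg − gΔf as a divergence. -/
lemma partialDeriv_wronskian {f g : Ambient n → 𝕜} (hf : ContDiffOn ℝ ∞ f {0}ᶜ)
    (hg : ContDiffOn ℝ ∞ g {0}ᶜ) (i : Fin (n + 1)) {x : Ambient n} (hx : x ≠ 0) :
    partialDeriv i (fun y => f y * partialDeriv i g y - g y * partialDeriv i f y) x =
      f x * partialDeriv i (partialDeriv i g) x - g x * partialDeriv i (partialDeriv i f) x := by
  have hd : ∀ {h : Ambient n → 𝕜}, ContDiffOn ℝ ∞ h {0}ᶜ → DifferentiableAt ℝ h x := fun hh =>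
    (hh.contDiffAt (isOpen_compl_singleton.mem_nhds hx)).differentiableAt (by simp)
  have h := ((hd hf).hasFDerivAt.mul (hd (contDiffOn_partialDeriv hg i)).hasFDerivAt).sub
    ((hd hg).hasFDerivAt.mul (hd (contDiffOn_partialDeriv hf i)).hasFDerivAt)
  have e := congrArg (fun L => L (EuclideanSpace.basisFun (Fin (n + 1)) ℝ i)) h.fderiv
  rw [partialDeriv]
  refine e.trans ?_
  simp only [partialDeriv, sub_apply, add_apply,
    smul_apply, smul_eq_mul]
  ring

lemma exists_radialCutoff : ∃ h : ℝ → ℝ, IsRadialCutoff h ∧ (∀ s, 0 ≤ h s) ∧ h 1 ≠ 0 := by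
  let f : ContDiffBump (1 : ℝ) := ⟨1 / 4, 1 / 2, by norm_num, by norm_num⟩
  refine ⟨f, ⟨f.contDiff, f.hasCompactSupport, ?_⟩, fun s => f.nonneg, ?_⟩
  · rw [f.tsupport_eq]
    intro s hs
    have : |s - 1| ≤ 1 / 2 := hs
    have := abs_le.1 this
    simp only [Set.mem_Ioi]
    linarith
  · rw [f.one_of_mem_closedBall (by simp [f])]
    norm_num

/-- **Green's second identity** on the sphere. -/
theorem integral_mul_laplaceBeltrami_comm {φ ψ : Sphere n → 𝕜} (hφ : SmoothOnSphere φ)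
    (hψ : SmoothOnSphere ψ) :
    ∫ x, φ x * laplaceBeltrami ψ x ∂(surfaceMeasure n) =
      ∫ x, laplaceBeltrami φ x * ψ x ∂(surfaceMeasure n) := by
  obtain ⟨h, hh, hpos, h1⟩ := exists_radialCutoff
  -- The extra factor s = ‖x‖² cancels the ‖x‖⁻² in `laplacian_radialExtension`.
  have hη : IsRadialCutoff fun s => h s * s :=
    ⟨hh.contDiff.mul contDiff_id, hh.hasCompactSupport.mul_right,
      (closure_mono (Function.support_mul_subset_left h fun s => s)).trans hh.tsupport_subset⟩
  set Φ := radialExtension φ with hΦ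
  set Ψ := radialExtension ψ with hΨ
  set c : 𝕜 := ∫ r : Set.Ioi (0 : ℝ), (h ((r : ℝ) ^ 2) : 𝕜) ∂(Measure.volumeIoiPow n) with hc
  -- Polar coordinates with g = 1 would otherwise make the integral of a nonnegative, nonzero
  -- continuous function vanish.
  have hc0 : c ≠ 0 := by
    intro hc0
    have e := integral_norm_mul_radialExtension (n := n) (fun r => h (r ^ 2)) (fun _ => (1 : 𝕜))
    rw [← hc, hc0, mul_zero] at e
    have e2 : ∫ x : Ambient n, ((h (‖x‖ ^ 2) : ℝ) : 𝕜) = 0 := by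
      rw [← e]
      refine integral_congr_ae ?_
      filter_upwards [compl_mem_ae_iff.2 (measure_singleton (0 : Ambient n))] with x hx
      rw [radialExtension_of_ne_zero _ hx, mul_one]
    rw [integral_ofReal, RCLike.ofReal_eq_zero] at e2
    have hp := (hh.contDiff_norm_sq (n := n)).continuous.integral_pos_of_hasCompactSupport_nonneg_nonzero
      (μ := volume) hh.hasCompactSupport_norm_sq (fun x => hpos _)
      (x := EuclideanSpace.single 0 1) (by simpa using h1)
    exact hp.ne' e2
  have hdiv := hη.integral_smul_divergence_eq_zero (n := n) (𝕜 := 𝕜)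
    (G := fun i y => Φ y * partialDeriv i Ψ y - Ψ y * partialDeriv i Φ y)
    (fun i => (ContDiffOn.mul hφ (contDiffOn_partialDeriv hψ i)).sub
      (ContDiffOn.mul hψ (contDiffOn_partialDeriv hφ i)))
    (fun x hx => by
      have e1 := sum_smul_partialDeriv_radialExtension hφ hx
      have e2 := sum_smul_partialDeriv_radialExtension hψ hx
      simp only [smul_sub, ← mul_smul_comm, Finset.sum_sub_distrib, ← Finset.mul_sum]
      rw [e1, e2]
      simp)
  have hpolar := integral_norm_mul_radialExtension (n := n) (fun r => h (r ^ 2))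
    (fun x => φ x * laplaceBeltrami ψ x - laplaceBeltrami φ x * ψ x)
  have heq : ∫ x : Ambient n, ((h (‖x‖ ^ 2) : ℝ) : 𝕜) * radialExtension
      (fun x => φ x * laplaceBeltrami ψ x - laplaceBeltrami φ x * ψ x) x = 0 := by
    rw [← hdiv]
    refine integral_congr_ae ?_
    filter_upwards [compl_mem_ae_iff.2 (measure_singleton (0 : Ambient n))] with x hx
    have hx : x ≠ 0 := hx
    have hn : (‖x‖ ^ 2) ≠ 0 := by positivity
    change _ = (h (‖x‖ ^ 2) * ‖x‖ ^ 2) •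
      ∑ i, partialDeriv i (fun y => Φ y * partialDeriv i Ψ y - Ψ y * partialDeriv i Φ y) x
    rw [Finset.sum_congr rfl fun i _ => partialDeriv_wronskian hφ hψ i hx]
    simp only [Finset.sum_sub_distrib, ← Finset.mul_sum]
    rw [← laplacian_eq_sum_partialDeriv ((hφ.contDiffAt hx).of_le two_le_infty),
      ← laplacian_eq_sum_partialDeriv ((hψ.contDiffAt hx).of_le two_le_infty),
      laplacian_radialExtension φ hx, laplacian_radialExtension ψ hx, mul_smul_comm, mul_smul_comm,
      ← smul_sub, smul_smul, mul_assoc, mul_inv_cancel₀ hn, mul_one, RCLike.real_smul_eq_coe_mul]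
    simp only [radialExtension_of_ne_zero _ hx]
    ring
  rw [heq] at hpolar
  have h0 := (mul_eq_zero.1 hpolar.symm).resolve_right hc0
  have hi : ∀ {f g : Sphere n → 𝕜}, Continuous f → Continuous g →
      Integrable (fun x => f x * g x) (surfaceMeasure n) := fun hf hg =>
    (hf.mul hg).integrable_of_hasCompactSupport (HasCompactSupport.of_compactSpace _)
  rw [integral_sub (hi hφ.continuous hψ.continuous_laplaceBeltrami)
    (hi hφ.continuous_laplaceBeltrami hψ.continuous)] at h0
  exact sub_eq_zero.1 h0

end Green

/-! ### Spherical harmonics as eigenfunctions. -/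

section Eigenfunctions

open Filter Topology

variable {𝕜 : Type*} [RCLike 𝕜] {n : ℕ}

/-- The polynomial function on `ℝ^{n+1}` defined by `p`. -/
def polyFun (p : MvPolynomial (Fin (n + 1)) 𝕜) (x : Ambient n) : 𝕜 :=
  eval (fun i => ((x i : ℝ) : 𝕜)) p

lemma restrictToSphere_apply (p : MvPolynomial (Fin (n + 1)) 𝕜) (x : Sphere n) :
    restrictToSphere 𝕜 n p x = polyFun p x := rfl

lemma hasFDerivAt_coord (i : Fin (n + 1)) (x : Ambient n) :
    HasFDerivAt (fun x : Ambient n => ((x i : ℝ) : 𝕜))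
      (RCLike.ofRealCLM.comp (EuclideanSpace.proj i : Ambient n →L[ℝ] ℝ)) x :=
  (RCLike.ofRealCLM.comp (EuclideanSpace.proj i : Ambient n →L[ℝ] ℝ)).hasFDerivAt

lemma contDiff_polyFun (p : MvPolynomial (Fin (n + 1)) 𝕜) : ContDiff ℝ ∞ (polyFun p) := by
  induction p using MvPolynomial.induction_on with
  | C a =>
    have : polyFun (C a : MvPolynomial (Fin (n + 1)) 𝕜) = fun _ => a := by ext; simp [polyFun]
    rw [this]
    exact contDiff_const
  | add p r hp hr =>
    have : polyFun (p + r) = fun x => polyFun p x + polyFun r x := by ext; simp [polyFun]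
    rw [this]
    exact hp.add hr
  | mul_X p i hp =>
    have : polyFun (p * X i) = fun x => polyFun p x * ((x i : ℝ) : 𝕜) := by ext; simp [polyFun]
    rw [this]
    exact hp.mul ((RCLike.ofRealCLM (K := 𝕜)).comp (EuclideanSpace.proj i : Ambient n →L[ℝ] ℝ)).contDiff

lemma partialDeriv_mul {f g : Ambient n → 𝕜} {x : Ambient n} (hf : DifferentiableAt ℝ f x)
    (hg : DifferentiableAt ℝ g x) (i : Fin (n + 1)) :
    partialDeriv i (fun y => f y * g y) x = partialDeriv i f x * g x + f x * partialDeriv i g x := by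
  have e := congrArg (fun L => L (EuclideanSpace.basisFun (Fin (n + 1)) ℝ i))
    (hf.hasFDerivAt.mul hg.hasFDerivAt).fderiv
  refine e.trans ?_
  simp only [partialDeriv, add_apply, smul_apply, smul_eq_mul]
  ring

lemma partialDeriv_add {f g : Ambient n → 𝕜} {x : Ambient n} (hf : DifferentiableAt ℝ f x)
    (hg : DifferentiableAt ℝ g x) (i : Fin (n + 1)) :
    partialDeriv i (fun y => f y + g y) x = partialDeriv i f x + partialDeriv i g x :=
  congrArg (fun L => L (EuclideanSpace.basisFun (Fin (n + 1)) ℝ i))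
    (hf.hasFDerivAt.add hg.hasFDerivAt).fderiv

lemma partialDeriv_congr {f g : Ambient n → 𝕜} {x : Ambient n} (h : f =ᶠ[𝓝 x] g)
    (i : Fin (n + 1)) : partialDeriv i f x = partialDeriv i g x := by
  rw [partialDeriv, h.fderiv_eq, partialDeriv]

lemma partialDeriv_polyFun (p : MvPolynomial (Fin (n + 1)) 𝕜) (i : Fin (n + 1)) (x : Ambient n) :
    partialDeriv i (polyFun p) x = polyFun (pderiv i p) x := by
  have hd : ∀ p : MvPolynomial (Fin (n + 1)) 𝕜, DifferentiableAt ℝ (polyFun p) x := fun p =>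
    (contDiff_polyFun p).differentiable (by simp) x
  induction p using MvPolynomial.induction_on with
  | C a =>
    have : polyFun (C a : MvPolynomial (Fin (n + 1)) 𝕜) = fun _ => a := by ext; simp [polyFun]
    simp [this, partialDeriv, polyFun]
  | add p r hp hr =>
    have : polyFun (p + r) = fun x => polyFun p x + polyFun r x := by ext; simp [polyFun]
    rw [this, partialDeriv_add (hd p) (hd r), hp, hr]
    simp [polyFun]
  | mul_X p j hp =>
    have : polyFun (p * X j) = fun x => polyFun p x * ((x j : ℝ) : 𝕜) := by ext; simp [polyFun]
    rw [this, partialDeriv_mul (hd p) (hasFDerivAt_coord j x).differentiableAt, hp]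
    have h2 : partialDeriv i (fun x : Ambient n => ((x j : ℝ) : 𝕜)) x = if i = j then 1 else 0 := by
      rw [partialDeriv, (hasFDerivAt_coord j x).fderiv]
      by_cases hij : i = j
      · simp [hij]
      · simp [hij, Ne.symm hij]
    rw [h2]
    by_cases hij : i = j
    · subst hij
      simp [polyFun]
      ring
    · simp [polyFun, hij, pderiv_X_of_ne (Ne.symm hij)]
      ring

lemma contDiffAt_inv_norm_pow (k : ℕ) {x : Ambient n} (hx : x ≠ 0) :
    ContDiffAt ℝ ∞ (fun y : Ambient n => (((‖y‖⁻¹) ^ k : ℝ) : 𝕜)) x :=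
  (RCLike.ofRealCLM (K := 𝕜)).contDiff.contDiffAt.comp x
    (((contDiffAt_norm ℝ hx).inv (norm_ne_zero_iff.2 hx)).pow k)

lemma partialDeriv_inv_norm_pow (k : ℕ) {x : Ambient n} (hx : x ≠ 0) (i : Fin (n + 1)) :
    partialDeriv i (fun y : Ambient n => (((‖y‖⁻¹) ^ k : ℝ) : 𝕜)) x =
      -(k : 𝕜) * (((‖x‖⁻¹) ^ (k + 2) : ℝ) : 𝕜) * ((x i : ℝ) : 𝕜) := by
  have hx' : ‖x‖ ≠ 0 := norm_ne_zero_iff.2 hx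
  set e : Ambient n := EuclideanSpace.basisFun (Fin (n + 1)) ℝ i
  have hd : HasFDerivAt (fun y : Ambient n => ‖y‖) (fderiv ℝ (fun y : Ambient n => ‖y‖) x) x :=
    ((contDiffAt_norm ℝ hx).differentiableAt (n := 1) (by simp)).hasFDerivAt
  have h1 : fderiv ℝ (fun y : Ambient n => ‖y‖) x e = ‖x‖⁻¹ * x i := by
    -- The derivative of the norm is read off by differentiating ‖y‖² in two ways.
    have ha := congrArg (fun L => L e) ((hd.pow 2).unique (hasStrictFDerivAt_norm_sq x).hasFDerivAt)
    simp [e, EuclideanSpace.inner_single_right] at ha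
    field_simp
    simp only [e, EuclideanSpace.basisFun_apply]
    linarith
  have h2 := RCLike.ofRealCLM.hasFDerivAt.comp x
    (((hasDerivAt_inv hx').comp_hasFDerivAt x hd).pow k) (𝕜 := ℝ) (g := fun r : ℝ => (r : 𝕜))
  have e2 := congrArg (fun L => L e) h2.fderiv
  refine e2.trans ?_
  simp only [ContinuousLinearMap.comp_apply, smul_apply, h1, smul_eq_mul, RCLike.ofRealCLM_apply,
    nsmul_eq_mul, Function.comp_apply]
  rcases k with _ | k
  · simp
  · simp only [Nat.add_sub_cancel]
    push_cast
    rw [← inv_pow]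
    ring

/-- The function `|x|^{-k} p(x)`. -/
def invNormMulPoly (k : ℕ) (p : MvPolynomial (Fin (n + 1)) 𝕜) (x : Ambient n) : 𝕜 :=
  (((‖x‖⁻¹) ^ k : ℝ) : 𝕜) * polyFun p x

lemma contDiffAt_invNormMulPoly (k : ℕ) (p : MvPolynomial (Fin (n + 1)) 𝕜) {x : Ambient n}
    (hx : x ≠ 0) : ContDiffAt ℝ ∞ (invNormMulPoly k p) x :=
  (contDiffAt_inv_norm_pow k hx).mul (contDiff_polyFun p).contDiffAt

/-- Derivatives stay within sums of functions |x|^{−k}p, so second derivatives come from a second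
application. -/
lemma partialDeriv_invNormMulPoly (k : ℕ) (p : MvPolynomial (Fin (n + 1)) 𝕜) {x : Ambient n}
    (hx : x ≠ 0) (i : Fin (n + 1)) :
    partialDeriv i (invNormMulPoly k p) x =
      invNormMulPoly (k + 2) (-(C (k : 𝕜) * (X i * p))) x + invNormMulPoly k (pderiv i p) x := by
  refine (partialDeriv_mul ((contDiffAt_inv_norm_pow k hx).differentiableAt (by simp))
    ((contDiff_polyFun p).differentiable (by simp) x) i).trans ?_
  rw [partialDeriv_inv_norm_pow k hx, partialDeriv_polyFun]
  simp only [invNormMulPoly, polyFun, map_neg, map_mul, eval_C, eval_X]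
  ring

/-- At |x| = 1, harmonicity and Euler's identity leave the factor ℓ(ℓ+2) − (n+1)ℓ − 2ℓ² = −ℓ(ℓ+n−1).
-/
lemma laplacian_invNormMulPoly {ℓ : ℕ} {p : MvPolynomial (Fin (n + 1)) 𝕜}
    (hp : p ∈ harmonicPolynomials 𝕜 n ℓ) (x : Sphere n) :
    (Δ (invNormMulPoly ℓ p)) (x : Ambient n) = -((eigenvalue n ℓ : ℝ) : 𝕜) * polyFun p x := by
  have hx := coe_sphere_ne_zero x
  have hx1 : ‖(x : Ambient n)‖ = 1 := norm_eq_of_mem_sphere x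
  have hd : ∀ k (r : MvPolynomial (Fin (n + 1)) 𝕜),
      DifferentiableAt ℝ (invNormMulPoly k r) (x : Ambient n) := fun k r =>
    (contDiffAt_invNormMulPoly k r hx).differentiableAt (by simp)
  have hom : p.IsHomogeneous ℓ := hp.1
  have hharm : polyLaplacian 𝕜 n p = 0 := hp.2
  rw [laplacian_eq_sum_partialDeriv ((contDiffAt_invNormMulPoly ℓ p hx).of_le two_le_infty)]
  have key : ∀ i, partialDeriv i (partialDeriv i (invNormMulPoly ℓ p)) (x : Ambient n) =
      polyFun (C ((ℓ : 𝕜) * (ℓ + 2)) * (X i ^ 2 * p) - C (ℓ : 𝕜) * p -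
        C (2 * (ℓ : 𝕜)) * (X i * pderiv i p) + pderiv i (pderiv i p)) x := by
    intro i
    have hev : partialDeriv i (invNormMulPoly ℓ p) =ᶠ[𝓝 (x : Ambient n)] fun y =>
        invNormMulPoly (ℓ + 2) (-(C (ℓ : 𝕜) * (X i * p))) y + invNormMulPoly ℓ (pderiv i p) y := by
      filter_upwards [isOpen_compl_singleton.mem_nhds hx] with y hy using
        partialDeriv_invNormMulPoly ℓ p hy i
    rw [partialDeriv_congr hev, partialDeriv_add (hd _ _) (hd _ _),
      partialDeriv_invNormMulPoly _ _ hx, partialDeriv_invNormMulPoly _ _ hx]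
    simp only [invNormMulPoly, hx1, polyFun, inv_one, one_pow, RCLike.ofReal_one, one_mul,
      map_neg, map_mul, map_add, map_sub, map_pow, eval_C, eval_X, Derivation.leibniz,
      pderiv_X_self, pderiv_C, smul_eq_mul]
    push_cast
    simp
    ring
  rw [Finset.sum_congr rfl fun i _ => key i]
  have hsum : ∑ i, (C ((ℓ : 𝕜) * (ℓ + 2)) * (X i ^ 2 * p) - C (ℓ : 𝕜) * p -
        C (2 * (ℓ : 𝕜)) * (X i * pderiv i p) + pderiv i (pderiv i p)) =
      C ((ℓ : 𝕜) * (ℓ + 2)) * (normSqPoly 𝕜 n * p) - C ((n + 1) * (ℓ : 𝕜)) * p -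
        C (2 * (ℓ : 𝕜)) * (ℓ • p) := by
    have hR : normSqPoly 𝕜 n = ∑ i, X i ^ 2 := rfl
    simp only [Finset.sum_add_distrib, Finset.sum_sub_distrib, ← Finset.mul_sum,
      ← Finset.sum_mul, hom.sum_X_mul_pderiv, ← polyLaplacian_apply, hharm, ← hR,
      Finset.sum_const, Finset.card_univ, Fintype.card_fin, nsmul_eq_mul]
    simp
    ring
  have e := congrArg (fun r => polyFun r (x : Ambient n)) hsum
  simp only [polyFun, map_sum] at e ⊢
  rw [e]
  simp only [map_sub, map_mul, eval_C, eval_normSqPoly_sphere, eigenvalue, nsmul_eq_mul, map_natCast]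
  push_cast
  ring

lemma eval_smul_of_isHomogeneous {ℓ : ℕ} {p : MvPolynomial (Fin (n + 1)) 𝕜}
    (hp : p.IsHomogeneous ℓ) (c : 𝕜) (y : Fin (n + 1) → 𝕜) :
    eval (c • y) p = c ^ ℓ * eval y p := by
  rw [eval_eq', eval_eq', Finset.mul_sum]
  refine Finset.sum_congr rfl fun d hd => ?_
  have hdeg : ∑ i, d i = ℓ := by
    rw [← hp (mem_support_iff.1 hd), ← Finsupp.degree_eq_sum, Finsupp.degree_eq_weight_one]
    rfl
  simp only [Pi.smul_apply, smul_eq_mul, mul_pow, Finset.prod_mul_distrib,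
    Finset.prod_pow_eq_pow_sum, hdeg]
  ring

lemma radialExtension_restrictToSphere {ℓ : ℕ} {p : MvPolynomial (Fin (n + 1)) 𝕜}
    (hp : p.IsHomogeneous ℓ) {x : Ambient n} (hx : x ≠ 0) :
    radialExtension (restrictToSphere 𝕜 n p) x = invNormMulPoly ℓ p x := by
  rw [radialExtension_of_ne_zero _ hx, restrictToSphere_apply, invNormMulPoly]
  simp only [polyFun]
  have : (fun i => (((‖x‖⁻¹ • x) i : ℝ) : 𝕜)) = ((‖x‖⁻¹ : ℝ) : 𝕜) • fun i => ((x i : ℝ) : 𝕜) := by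
    ext i
    simp
  rw [this, eval_smul_of_isHomogeneous hp]
  push_cast
  rfl

lemma smoothOnSphere_restrictToSphere {ℓ : ℕ} {p : MvPolynomial (Fin (n + 1)) 𝕜}
    (hp : p.IsHomogeneous ℓ) : SmoothOnSphere (restrictToSphere 𝕜 n p) := by
  have h : ContDiffOn ℝ ∞ (invNormMulPoly ℓ p) {0}ᶜ := fun x hx =>
    (contDiffAt_invNormMulPoly ℓ p hx).contDiffWithinAt
  exact h.congr fun x hx => radialExtension_restrictToSphere hp hx

/-- Spherical harmonics are eigenfunctions of the Laplace–Beltrami operator. -/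
theorem laplaceBeltrami_restrictToSphere {ℓ : ℕ} {p : MvPolynomial (Fin (n + 1)) 𝕜}
    (hp : p ∈ harmonicPolynomials 𝕜 n ℓ) (x : Sphere n) :
    laplaceBeltrami (restrictToSphere 𝕜 n p) x =
      -((eigenvalue n ℓ : ℝ) : 𝕜) * restrictToSphere 𝕜 n p x := by
  have hev : radialExtension (restrictToSphere 𝕜 n p) =ᶠ[𝓝 (x : Ambient n)] invNormMulPoly ℓ p := by
    filter_upwards [isOpen_compl_singleton.mem_nhds (coe_sphere_ne_zero x)] with y hy using
      radialExtension_restrictToSphere hp.1 hy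
  rw [laplaceBeltrami, (InnerProductSpace.laplacian_congr_nhds hev).eq_of_nhds,
    laplacian_invNormMulPoly hp, restrictToSphere_apply]

/-- `HasLaplaceBeltrami` pairs bilinearly whereas the inner product is sesquilinear; conjugate
harmonics translate between the two. -/
lemma starMap_mem_harmonicPolynomials {ℓ : ℕ} {p : MvPolynomial (Fin (n + 1)) 𝕜}
    (hp : p ∈ harmonicPolynomials 𝕜 n ℓ) :
    map (starRingEnd 𝕜) p ∈ harmonicPolynomials 𝕜 n ℓ := by
  have hom : p.IsHomogeneous ℓ := hp.1
  have hharm : polyLaplacian 𝕜 n p = 0 := hp.2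
  refine ⟨hom.map _, ?_⟩
  change polyLaplacian 𝕜 n _ = 0
  rw [polyLaplacian_apply] at hharm ⊢
  simp only [pderiv_map, ← map_sum, hharm, map_zero]

lemma restrictToSphere_starMap (p : MvPolynomial (Fin (n + 1)) 𝕜) :
    restrictToSphere 𝕜 n (map (starRingEnd 𝕜) p) = star (restrictToSphere 𝕜 n p) := by
  ext x
  change polyFun (map (starRingEnd 𝕜) p) x = starRingEnd 𝕜 (polyFun p x)
  simp only [polyFun]
  rw [eval_map, ← eval₂_id, hom_eval₂]
  congr 1
  ext i
  simp

end Eigenfunctions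

/-! ### Completeness, orthogonality and diagonalisation. -/

section HilbertBasis

variable {𝕜 : Type*} [RCLike 𝕜] {n : ℕ}

/-- The embedding of continuous functions on the sphere into `L₂`. -/
abbrev toL2 (𝕜 : Type*) [RCLike 𝕜] (n : ℕ) : C(Sphere n, 𝕜) →L[𝕜] L2Sphere 𝕜 n :=
  ContinuousMap.toLp 2 (surfaceMeasure n) 𝕜

lemma integral_mul_eq_inner (f : C(Sphere n, 𝕜)) (w : L2Sphere 𝕜 n) :
    ∫ x, f x * w x ∂(surfaceMeasure n) = inner 𝕜 (toL2 𝕜 n (star f)) w := by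
  rw [L2.inner_def]
  refine integral_congr_ae ?_
  filter_upwards [ContinuousMap.coeFn_toLp (p := 2) (𝕜 := 𝕜) (surfaceMeasure n) (star f)] with x hx
  rw [hx]
  simp [mul_comm]

/-- The star subalgebra of restrictions of polynomials to the sphere. -/
def polynomialSubalgebra (𝕜 : Type*) [RCLike 𝕜] (n : ℕ) : StarSubalgebra 𝕜 C(Sphere n, 𝕜) where
  carrier := Set.range (restrictToSphere 𝕜 n)
  mul_mem' := by
    rintro _ _ ⟨p, rfl⟩ ⟨r, rfl⟩
    exact ⟨p * r, by ext x; simp [restrictToSphere]⟩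
  add_mem' := by
    rintro _ _ ⟨p, rfl⟩ ⟨r, rfl⟩
    exact ⟨p + r, map_add _ _ _⟩
  algebraMap_mem' c := ⟨C c, by ext x; simp [restrictToSphere]⟩
  star_mem' := by
    rintro _ ⟨p, rfl⟩
    exact ⟨_, restrictToSphere_starMap p⟩

lemma polynomialSubalgebra_separatesPoints : (polynomialSubalgebra 𝕜 n).SeparatesPoints := by
  intro x y hxy
  obtain ⟨i, hi⟩ : ∃ i, (x : Ambient n) i ≠ (y : Ambient n) i := by
    by_contra! h
    exact hxy (Subtype.ext (PiLp.ext h))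
  refine ⟨_, ⟨restrictToSphere 𝕜 n (X i), ⟨X i, rfl⟩, rfl⟩, ?_⟩
  simpa [restrictToSphere] using hi

lemma dense_range_restrictToSphere :
    (LinearMap.range (restrictToSphere 𝕜 n)).topologicalClosure = ⊤ := by
  have h := ContinuousMap.starSubalgebra_topologicalClosure_eq_top_of_separatesPoints _
    (polynomialSubalgebra_separatesPoints (𝕜 := 𝕜) (n := n))
  exact congr_arg (Subalgebra.toSubmodule <| StarSubalgebra.toSubalgebra ·) h

lemma iSup_sphericalHarmonics_topologicalClosure :
    (⨆ ℓ, sphericalHarmonics 𝕜 n ℓ).topologicalClosure = ⊤ := by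
  have h := (ContinuousMap.toLp_denseRange 𝕜 (surfaceMeasure n) 𝕜 (p := 2)
    (by norm_num)).topologicalClosure_map_submodule (dense_range_restrictToSphere (n := n))
  rw [eq_top_iff, ← h]
  refine Submodule.topologicalClosure_mono ?_
  rintro _ ⟨_, ⟨p, rfl⟩, rfl⟩
  have hp := Submodule.mem_map_of_mem (f := (toL2 𝕜 n).toLinearMap) (restrictToSphere_mem_iSup p)
  rw [Submodule.map_iSup] at hp
  simp only [← Submodule.map_comp] at hp
  exact hp

lemma eigenvalue_nonneg (hn : 1 ≤ n) (ℓ : ℕ) : 0 ≤ eigenvalue n ℓ := by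
  have : (1 : ℝ) ≤ n := by exact_mod_cast hn
  have h : (0 : ℝ) ≤ ℓ := ℓ.cast_nonneg
  exact mul_nonneg h (by linarith)

/-- Distinct eigenvalues give orthogonality of different degrees. For n = 0 this fails, since λ₀ =
λ₁ = 0. -/
lemma eigenvalue_strictMono (hn : 1 ≤ n) : StrictMono (eigenvalue n) := by
  intro a b hab
  have h1 : (1 : ℝ) ≤ n := by exact_mod_cast hn
  have ha : (0 : ℝ) ≤ a := a.cast_nonneg
  have hab : (a : ℝ) < b := by exact_mod_cast hab
  unfold eigenvalue
  nlinarith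

/-- Green's identity with a spherical harmonic as second function. -/
lemma integral_laplaceBeltrami_mul_restrictToSphere {φ : Sphere n → 𝕜} (hφ : SmoothOnSphere φ)
    {ℓ : ℕ} {p : MvPolynomial (Fin (n + 1)) 𝕜} (hp : p ∈ harmonicPolynomials 𝕜 n ℓ) :
    ∫ x, laplaceBeltrami φ x * restrictToSphere 𝕜 n p x ∂(surfaceMeasure n) =
      -((eigenvalue n ℓ : ℝ) : 𝕜) * ∫ x, φ x * restrictToSphere 𝕜 n p x ∂(surfaceMeasure n) := by
  rw [← integral_mul_laplaceBeltrami_comm hφ (smoothOnSphere_restrictToSphere hp.1),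
    ← integral_const_mul]
  refine integral_congr_ae (ae_of_all _ fun x => ?_)
  simp only [laplaceBeltrami_restrictToSphere hp]
  ring

lemma orthogonalFamily_sphericalHarmonics (hn : 1 ≤ n) :
    OrthogonalFamily 𝕜 (fun ℓ => sphericalHarmonics 𝕜 n ℓ)
      fun ℓ => (sphericalHarmonics 𝕜 n ℓ).subtypeₗᵢ := by
  rintro a b hab ⟨_, p, hp, rfl⟩ ⟨_, r, hr, rfl⟩
  change inner 𝕜 (toL2 𝕜 n (restrictToSphere 𝕜 n p)) (toL2 𝕜 n (restrictToSphere 𝕜 n r)) = 0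
  have hp' := starMap_mem_harmonicPolynomials hp
  have h := integral_laplaceBeltrami_mul_restrictToSphere
    (smoothOnSphere_restrictToSphere hp'.1) hr
  simp only [laplaceBeltrami_restrictToSphere hp', mul_assoc, integral_const_mul] at h
  have e : inner 𝕜 (toL2 𝕜 n (restrictToSphere 𝕜 n p)) (toL2 𝕜 n (restrictToSphere 𝕜 n r)) =
      ∫ x, restrictToSphere 𝕜 n (map (starRingEnd 𝕜) p) x * restrictToSphere 𝕜 n r x
        ∂(surfaceMeasure n) := by
    rw [ContinuousMap.inner_toLp, restrictToSphere_starMap]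
    simp [mul_comm]
  rw [e]
  have hne : ((eigenvalue n a : ℝ) : 𝕜) ≠ ((eigenvalue n b : ℝ) : 𝕜) := by
    simpa using (eigenvalue_strictMono hn).injective.ne hab
  have h0 := sub_eq_zero.2 h
  rw [← sub_mul, mul_eq_zero] at h0
  refine h0.resolve_left fun h1 => hne ?_
  linear_combination -h1

/-- The index set of the basis of spherical harmonics: pairs `(ℓ, k)`. -/
abbrev HarmonicIndex (𝕜 : Type*) [RCLike 𝕜] (n : ℕ) : Type :=
  Σ ℓ : ℕ, Fin (Module.finrank 𝕜 (sphericalHarmonics 𝕜 n ℓ))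

lemma orthonormal_Y (hn : 1 ≤ n) :
    Orthonormal 𝕜 fun a : HarmonicIndex 𝕜 n => Y 𝕜 n a.1 a.2 := by
  have h := (orthogonalFamily_sphericalHarmonics (𝕜 := 𝕜) hn).orthonormal_sigma_orthonormal
    (v_family := fun ℓ k => stdOrthonormalBasis 𝕜 (sphericalHarmonics 𝕜 n ℓ) k)
    fun ℓ => (stdOrthonormalBasis 𝕜 (sphericalHarmonics 𝕜 n ℓ)).orthonormal
  unfold Y
  exact h

lemma sphericalHarmonics_le_span (ℓ : ℕ) : sphericalHarmonics 𝕜 n ℓ ≤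
    Submodule.span 𝕜 (Set.range fun a : HarmonicIndex 𝕜 n => Y 𝕜 n a.1 a.2) := by
  intro v hv
  have h := (stdOrthonormalBasis 𝕜 (sphericalHarmonics 𝕜 n ℓ)).sum_repr ⟨v, hv⟩
  have h' := congrArg (fun w : sphericalHarmonics 𝕜 n ℓ => (w : L2Sphere 𝕜 n)) h
  simp only [Submodule.coe_sum, Submodule.coe_smul] at h'
  rw [← h']
  exact Submodule.sum_mem _ fun k _ => Submodule.smul_mem _ _
    (Submodule.subset_span ⟨⟨ℓ, k⟩, rfl⟩)

/-- The Hilbert basis of `L₂(𝕊ⁿ)` consisting of the spherical harmonics `Y_{ℓk}`. -/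
def harmonicBasis (𝕜 : Type*) [RCLike 𝕜] {n : ℕ} (hn : 1 ≤ n) :
    HilbertBasis (HarmonicIndex 𝕜 n) 𝕜 (L2Sphere 𝕜 n) :=
  HilbertBasis.mk (orthonormal_Y hn) (by
    rw [← iSup_sphericalHarmonics_topologicalClosure]
    exact Submodule.topologicalClosure_mono (iSup_le sphericalHarmonics_le_span))

lemma harmonicBasis_apply (hn : 1 ≤ n) (a : HarmonicIndex 𝕜 n) :
    harmonicBasis 𝕜 hn a = Y 𝕜 n a.1 a.2 := by
  simp [harmonicBasis]

lemma harmonicBasis_repr (hn : 1 ≤ n) (v : L2Sphere 𝕜 n) (a : HarmonicIndex 𝕜 n) :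
    (harmonicBasis 𝕜 hn).repr v a = fourierCoeff v a.1 a.2 := by
  rw [HilbertBasis.repr_apply_apply, harmonicBasis_apply, fourierCoeff]

lemma exists_Y_eq (ℓ : ℕ) (k : Fin (Module.finrank 𝕜 (sphericalHarmonics 𝕜 n ℓ))) :
    ∃ p ∈ harmonicPolynomials 𝕜 n ℓ, toL2 𝕜 n (restrictToSphere 𝕜 n p) = Y 𝕜 n ℓ k :=
  (stdOrthonormalBasis 𝕜 (sphericalHarmonics 𝕜 n ℓ) k).2

/-- The self-adjoint Laplace–Beltrami operator is diagonal in the basis of spherical harmonics. -/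
theorem hasLaplaceBeltrami_iff (hn : 1 ≤ n) {v w : L2Sphere 𝕜 n} :
    HasLaplaceBeltrami v w ↔ ∀ ℓ k,
      fourierCoeff w ℓ k = -((eigenvalue n ℓ : ℝ) : 𝕜) * fourierCoeff v ℓ k := by
  constructor
  · intro h ℓ k
    obtain ⟨p, hp, hY⟩ := exists_Y_eq (𝕜 := 𝕜) (n := n) ℓ k
    have hp' := starMap_mem_harmonicPolynomials hp
    have e : ∀ u : L2Sphere 𝕜 n, fourierCoeff u ℓ k =
        ∫ x, restrictToSphere 𝕜 n (map (starRingEnd 𝕜) p) x * u x ∂(surfaceMeasure n) := by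
      intro u
      rw [integral_mul_eq_inner, restrictToSphere_starMap, star_star, hY, fourierCoeff]
    rw [e, e, h _ (smoothOnSphere_restrictToSphere hp'.1), ← integral_const_mul]
    simp only [laplaceBeltrami_restrictToSphere hp', mul_assoc]
  · intro h φ hφ
    let f : C(Sphere n, 𝕜) := ⟨φ, hφ.continuous⟩
    let g : C(Sphere n, 𝕜) := ⟨laplaceBeltrami φ, hφ.continuous_laplaceBeltrami⟩
    have e1 : ∫ x, φ x * w x ∂(surfaceMeasure n) = inner 𝕜 (toL2 𝕜 n (star f)) w :=
      integral_mul_eq_inner f w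
    have e2 : ∫ x, laplaceBeltrami φ x * v x ∂(surfaceMeasure n) =
        inner 𝕜 (toL2 𝕜 n (star g)) v := integral_mul_eq_inner g v
    -- Both pairings are expanded by Parseval and agree term by term: Green's identity moves Δ* from
    -- φ to the harmonic, producing the same factor −λ_ℓ as in `hw`.
    rw [e1, e2, ← (harmonicBasis 𝕜 hn).tsum_inner_mul_inner,
      ← (harmonicBasis 𝕜 hn).tsum_inner_mul_inner]
    refine tsum_congr fun a => ?_
    have hw := h a.1 a.2
    simp only [fourierCoeff] at hw
    simp only [harmonicBasis_apply]
    obtain ⟨p, hp, hY⟩ := exists_Y_eq (𝕜 := 𝕜) (n := n) a.1 a.2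
    have e3 : inner 𝕜 (toL2 𝕜 n (star g)) (Y 𝕜 n a.1 a.2) =
        -((eigenvalue n a.1 : ℝ) : 𝕜) * inner 𝕜 (toL2 𝕜 n (star f)) (Y 𝕜 n a.1 a.2) := by
      have := integral_laplaceBeltrami_mul_restrictToSphere hφ hp
      simp only [← hY, ContinuousMap.inner_toLp]
      simpa [f, g, mul_comm] using this
    rw [e3, hw]
    ring

end HilbertBasis

/-! ### Solution, uniqueness and smoothing estimate. -/

section HeatEquation

open Filter Topology

variable {𝕜 : Type*} [RCLike 𝕜] {n : ℕ}

/-- The `k`-th time derivative of the solution of the heat equation on the sphere, as a series of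
spherical harmonics. -/
def sphereFlow (hn : 1 ≤ n) (v : L2Sphere 𝕜 n) (k : ℕ) (t : ℝ) : L2Sphere 𝕜 n :=
  heatFlow (harmonicBasis 𝕜 hn) (fun a => eigenvalue n a.1) v k t

lemma fourierCoeff_sphereFlow (hn : 1 ≤ n) (v : L2Sphere 𝕜 n) (k : ℕ) {t : ℝ} (ht : 0 < t)
    (ℓ : ℕ) (j : Fin (Module.finrank 𝕜 (sphericalHarmonics 𝕜 n ℓ))) :
    fourierCoeff (sphereFlow hn v k t) ℓ j =
      (expMultiplier k t (eigenvalue n ℓ) : 𝕜) * fourierCoeff v ℓ j := by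
  have h := repr_heatFlow (harmonicBasis 𝕜 hn) (μ := fun a => eigenvalue n a.1)
    (fun a => eigenvalue_nonneg hn a.1) v k ht ⟨ℓ, j⟩
  rwa [harmonicBasis_repr, harmonicBasis_repr] at h

lemma fourierCoeff_sphereFlow_zero (hn : 1 ≤ n) (v : L2Sphere 𝕜 n) {t : ℝ} (ht : 0 ≤ t)
    (ℓ : ℕ) (j : Fin (Module.finrank 𝕜 (sphericalHarmonics 𝕜 n ℓ))) :
    fourierCoeff (sphereFlow hn v 0 t) ℓ j =
      (expMultiplier 0 t (eigenvalue n ℓ) : 𝕜) * fourierCoeff v ℓ j := by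
  have h := repr_heatFlow_zero (harmonicBasis 𝕜 hn) (μ := fun a => eigenvalue n a.1)
    (fun a => eigenvalue_nonneg hn a.1) v ht ⟨ℓ, j⟩
  rwa [harmonicBasis_repr, harmonicBasis_repr] at h

lemma isHeatSolution_sphereFlow (hn : 1 ≤ n) (v : L2Sphere 𝕜 n) :
    IsHeatSolution v (sphereFlow hn v 0) := by
  have hμ : ∀ a : HarmonicIndex 𝕜 n, 0 ≤ eigenvalue n a.1 := fun a => eigenvalue_nonneg hn a.1
  have h0 := continuousOn_heatFlow_zero (harmonicBasis 𝕜 hn) hμ v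
  have h1 := heatFlow_zero_zero (harmonicBasis 𝕜 hn) hμ v
  refine ⟨h0, h1, fun t ht => ?_⟩
  have h2 := hasDerivAt_heatFlow (harmonicBasis 𝕜 hn) hμ v 0 ht
  refine ⟨sphereFlow hn v 1 t, (hasLaplaceBeltrami_iff hn).2 fun ℓ k => ?_, h2⟩
  rw [fourierCoeff_sphereFlow hn v 1 ht, fourierCoeff_sphereFlow hn v 0 ht]
  simp [expMultiplier, mul_assoc]

/-- A function that satisfies `f' = -μ f` for `t > 0` and is continuous at `0` is an
exponential. -/
lemma eq_exp_mul_of_hasDerivAt {f : ℝ → 𝕜} {μ : ℝ} (hf : ContinuousOn f (Set.Ici 0))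
    (hd : ∀ t, 0 < t → HasDerivAt f (-(μ : 𝕜) * f t) t) {t : ℝ} (ht : 0 ≤ t) :
    f t = ((Real.exp (-(t * μ)) : ℝ) : 𝕜) * f 0 := by
  set g : ℝ → 𝕜 := fun s => ((Real.exp (s * μ) : ℝ) : 𝕜) * f s with hg
  have hgc : ContinuousOn g (Set.Ici 0) :=
    (RCLike.continuous_ofReal.comp (by fun_prop)).continuousOn.mul hf
  have hgd : ∀ s, 0 < s → HasDerivAt g 0 s := by
    intro s hs
    have h1 : HasDerivAt (fun s : ℝ => ((Real.exp (s * μ) : ℝ) : 𝕜))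
        ((Real.exp (s * μ) * (1 * μ) : ℝ) : 𝕜) s :=
      (RCLike.ofRealCLM (K := 𝕜)).hasFDerivAt.comp_hasDerivAt s
        ((hasDerivAt_id s).mul_const μ).exp
    refine (h1.mul (hd s hs)).congr_deriv ?_
    push_cast
    ring
  have hconst : g t = g 0 := by
    rcases ht.eq_or_lt with rfl | ht
    · rfl
    have hlim : Tendsto g (𝓝[>] 0) (𝓝 (g 0)) :=
      (hgc 0 Set.self_mem_Ici).mono_left (nhdsWithin_mono _ Set.Ioi_subset_Ici_self)
    -- The derivative is known only for positive times, so constancy is proved on [s, t] and carried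
    -- to 0 by continuity.
    have hev : ∀ᶠ s in 𝓝[>] (0 : ℝ), g s = g t := by
      filter_upwards [Ioo_mem_nhdsGT ht] with s hs
      exact (constant_of_has_deriv_right_zero (hgc.mono fun x hx => hs.1.le.trans hx.1)
        (fun x hx => (hgd x (hs.1.trans_le hx.1)).hasDerivWithinAt) t
        (Set.right_mem_Icc.2 hs.2.le)).symm
    exact tendsto_nhds_unique (tendsto_const_nhds.congr' (hev.mono fun _ h => h.symm)) hlim
  simp only [hg, zero_mul, Real.exp_zero, RCLike.ofReal_one, one_mul] at hconst
  rw [← hconst, ← mul_assoc, ← RCLike.ofReal_mul, ← Real.exp_add]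
  simp

/-- Pairing with a basis vector is continuous and real-linear, so each Fourier coefficient of a
solution satisfies y' = −λ_ℓ y and is determined by its initial value. -/
lemma IsHeatSolution.eq_sphereFlow (hn : 1 ≤ n) {v : L2Sphere 𝕜 n} {u : ℝ → L2Sphere 𝕜 n}
    (hu : IsHeatSolution v u) {t : ℝ} (ht : 0 ≤ t) : u t = sphereFlow hn v 0 t := by
  apply (harmonicBasis 𝕜 hn).repr.injective
  ext a
  rw [harmonicBasis_repr, harmonicBasis_repr, fourierCoeff_sphereFlow_zero hn v ht]
  let L : L2Sphere 𝕜 n →L[ℝ] 𝕜 := (innerSL 𝕜 (Y 𝕜 n a.1 a.2)).restrictScalars ℝ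
  have hL : ∀ w, L w = fourierCoeff w a.1 a.2 := fun w => rfl
  have h := eq_exp_mul_of_hasDerivAt (f := fun s => L (u s)) (μ := eigenvalue n a.1)
    (L.continuous.comp_continuousOn hu.continuousOn) (fun s hs => ?_) ht
  · simpa only [hL, hu.initial, expMultiplier, pow_zero, one_mul] using h
  · obtain ⟨w, hw, hd⟩ := hu.equation s hs
    have := L.hasFDerivAt.comp_hasDerivAt s hd
    rw [hL w, (hasLaplaceBeltrami_iff hn).1 hw, ← hL] at this
    exact this

lemma isHeatSolution_heatSemigroup (hn : 1 ≤ n) (v : L2Sphere 𝕜 n) :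
    IsHeatSolution v fun t => heatSemigroup t v :=
  Classical.epsilon_spec (p := fun u : ℝ → L2Sphere 𝕜 n => IsHeatSolution v u)
    ⟨_, isHeatSolution_sphereFlow hn v⟩

lemma heatSemigroup_eq_sphereFlow (hn : 1 ≤ n) (v : L2Sphere 𝕜 n) {t : ℝ} (ht : 0 ≤ t) :
    heatSemigroup t v = sphereFlow hn v 0 t :=
  (isHeatSolution_heatSemigroup hn v).eq_sphereFlow hn ht

lemma exists_rpow_mul_exp_neg_le {a : ℝ} (ha : 0 ≤ a) :
    ∃ K : ℝ, 0 ≤ K ∧ ∀ x : ℝ, 0 ≤ x → x ^ a * Real.exp (-x) ≤ K := by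
  -- x^a is at most (1+x)^⌈a⌉, which one term of the exponential series bounds by ⌈a⌉! e^{1+x}.
  refine ⟨⌈a⌉₊.factorial * Real.exp 1, by positivity, fun x hx => ?_⟩
  have h1 : x ^ a ≤ (1 + x) ^ ⌈a⌉₊ := by
    rw [← Real.rpow_natCast]
    exact (Real.rpow_le_rpow hx (by linarith) ha).trans
      (Real.rpow_le_rpow_of_exponent_le (by linarith) (Nat.le_ceil a))
  have h2 := Real.pow_div_factorial_le_exp (1 + x) (by linarith) ⌈a⌉₊
  rw [div_le_iff₀ (by positivity)] at h2
  calc x ^ a * Real.exp (-x) ≤ (Real.exp (1 + x) * ⌈a⌉₊.factorial) * Real.exp (-x) := by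
        gcongr
        exact h1.trans h2
    _ = ⌈a⌉₊.factorial * Real.exp 1 * (Real.exp x * Real.exp (-x)) := by rw [Real.exp_add]; ring
    _ = _ := by rw [← Real.exp_add]; simp

/-- With x = t(1+μ), the bound on x^a e^{−x} gives the power t^{−a}, a = (ν−q)/2 + m. The weight is
1+μ but the decay only e^{−tμ}; the discrepancy e^t ≤ e^T is the source of the dependence on T. -/
lemma exists_smoothing_bound {q ν : ℝ} (hqν : q ≤ ν) (m : ℕ) (T : ℝ) :
    ∃ C : ℝ, 0 ≤ C ∧ ∀ t : ℝ, 0 < t → t ≤ T → ∀ μ : ℝ, 0 ≤ μ →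
      (1 + μ) ^ ν * expMultiplier m t μ ^ 2 ≤
        (C * t ^ (-(ν - q) / 2 - (m : ℝ))) ^ 2 * (1 + μ) ^ q := by
  set a : ℝ := (ν - q) / 2 + m with ha
  have ha0 : 0 ≤ a := add_nonneg (by linarith) m.cast_nonneg
  obtain ⟨K, hK, hbound⟩ := exists_rpow_mul_exp_neg_le ha0
  refine ⟨K * Real.exp T, by positivity, fun t ht htT μ hμ => ?_⟩
  have hμ1 : 0 < 1 + μ := by linarith
  have hexp : -(ν - q) / 2 - (m : ℝ) = -a := by rw [ha]; ring
  have h1 : (1 + μ) ^ a * Real.exp (-(t * μ)) ≤ K * Real.exp T * t ^ (-a) := by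
    have h := hbound (t * (1 + μ)) (by positivity)
    rw [Real.mul_rpow ht.le hμ1.le] at h
    have e1 : Real.exp (-(t * μ)) = Real.exp (-(t * (1 + μ))) * Real.exp t := by
      rw [← Real.exp_add]
      ring_nf
    have e2 : t ^ (-a) * t ^ a = 1 := by rw [← Real.rpow_add ht]; simp
    calc (1 + μ) ^ a * Real.exp (-(t * μ))
        = (t ^ a * (1 + μ) ^ a * Real.exp (-(t * (1 + μ)))) * Real.exp t * t ^ (-a) := by
          rw [e1]
          linear_combination
            (-(1 + μ) ^ a * Real.exp (-(t * (1 + μ))) * Real.exp t) * e2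
      _ ≤ K * Real.exp T * t ^ (-a) := by gcongr
  have h2 : (1 + μ) ^ ((ν - q) / 2) * |expMultiplier m t μ| ≤ K * Real.exp T * t ^ (-a) := by
    refine le_trans ?_ h1
    rw [expMultiplier, abs_mul, abs_pow, abs_neg, abs_of_nonneg hμ, Real.abs_exp, ha,
      Real.rpow_add hμ1, Real.rpow_natCast, ← mul_assoc]
    gcongr
    linarith
  have h3 : (1 + μ) ^ ν = ((1 + μ) ^ ((ν - q) / 2)) ^ 2 * (1 + μ) ^ q := by
    rw [← Real.rpow_natCast, ← Real.rpow_mul hμ1.le, ← Real.rpow_add hμ1]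
    congr 1
    push_cast
    ring
  rw [hexp, h3, mul_right_comm, ← sq_abs (expMultiplier m t μ), ← mul_pow]
  gcongr

lemma sobolevTerm_nonneg (hn : 1 ≤ n) (σ : ℝ) (v : L2Sphere 𝕜 n) (ℓ : ℕ) :
    0 ≤ sobolevTerm σ v ℓ := by
  have := eigenvalue_nonneg hn ℓ
  unfold sobolevTerm
  positivity

lemma memSobolev_and_sobolevNorm_le {σ τ K : ℝ} (hn : 1 ≤ n) (hK : 0 ≤ K) {v w : L2Sphere 𝕜 n}
    (hv : MemSobolev σ v) (h : ∀ ℓ, sobolevTerm τ w ℓ ≤ K ^ 2 * sobolevTerm σ v ℓ) :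
    MemSobolev τ w ∧ sobolevNorm τ w ≤ K * sobolevNorm σ v := by
  have hv' : Summable fun ℓ => K ^ 2 * sobolevTerm σ v ℓ := Summable.mul_left _ hv
  have hw : Summable (sobolevTerm τ w) :=
    Summable.of_nonneg_of_le (sobolevTerm_nonneg hn τ w) h hv'
  refine ⟨hw, ?_⟩
  rw [sobolevNorm, sobolevNorm]
  refine Real.sqrt_le_iff.2 ⟨by positivity, ?_⟩
  rw [mul_pow, Real.sq_sqrt (tsum_nonneg (sobolevTerm_nonneg hn σ v)), ← tsum_mul_left]
  exact hw.tsum_le_tsum h hv'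

lemma sobolevTerm_sphereFlow (hn : 1 ≤ n) (σ : ℝ) (v : L2Sphere 𝕜 n) (k : ℕ) {t : ℝ} (ht : 0 < t)
    (ℓ : ℕ) : sobolevTerm σ (sphereFlow hn v k t) ℓ =
      (1 + eigenvalue n ℓ) ^ σ * expMultiplier k t (eigenvalue n ℓ) ^ 2 *
        ∑ j, ‖fourierCoeff v ℓ j‖ ^ 2 := by
  simp only [sobolevTerm, fourierCoeff_sphereFlow hn v k ht, norm_mul, mul_pow,
    RCLike.norm_ofReal, sq_abs, ← Finset.mul_sum, mul_assoc]

/-- The smoothing estimate for the time derivatives of the heat flow. -/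
lemma exists_sobolevNorm_sphereFlow_le (hn : 1 ≤ n) {q ν : ℝ} (hqν : q ≤ ν) (m : ℕ) (T : ℝ) :
    ∃ C : ℝ, ∀ v : L2Sphere 𝕜 n, MemSobolev q v → ∀ t : ℝ, 0 < t → t ≤ T →
      MemSobolev ν (sphereFlow hn v m t) ∧ sobolevNorm ν (sphereFlow hn v m t) ≤
        C * t ^ (-(ν - q) / 2 - (m : ℝ)) * sobolevNorm q v := by
  obtain ⟨C, hC, hbound⟩ := exists_smoothing_bound hqν m T
  refine ⟨C, fun v hv t ht htT => memSobolev_and_sobolevNorm_le hn (by positivity) hv fun ℓ => ?_⟩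
  rw [sobolevTerm_sphereFlow hn ν v m ht, sobolevTerm, ← mul_assoc]
  exact mul_le_mul_of_nonneg_right (hbound t ht htT _ (eigenvalue_nonneg hn ℓ)) (by positivity)

end HeatEquation

end SphereHeat

end

open SphereHeat in
theorem mainTheorem5 {𝕜 : Type*} [RCLike 𝕜] (n : ℕ) (hn : 1 ≤ n) (q ν : ℝ) (hq : 0 ≤ q)
    (hqν : q ≤ ν) (m : ℕ) :
    -- `t ↦ 𝓔(t) v` is the unique solution of the heat equation with initial value `v`
    (∀ v : L2Sphere 𝕜 n, IsHeatSolution v (fun t => heatSemigroup t v) ∧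
      ∀ u : ℝ → L2Sphere 𝕜 n, IsHeatSolution v u →
        ∀ t : ℝ, 0 ≤ t → u t = heatSemigroup t v) ∧
    (∀ v : L2Sphere 𝕜 n, MemSobolev q v → ∀ t : ℝ, 0 < t → MemSobolev ν (heatSemigroup t v)) ∧
    ∀ T : ℝ, 0 < T → ∃ C : ℝ, ∀ v : L2Sphere 𝕜 n, MemSobolev q v → ∀ t : ℝ, 0 < t → t ≤ T →
      ContDiffAt ℝ m (fun s => heatSemigroup s v) t ∧
      MemSobolev ν (iteratedDeriv m (fun s => heatSemigroup s v) t) ∧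
      sobolevNorm ν (iteratedDeriv m (fun s => heatSemigroup s v) t) ≤
        C * t ^ (-(ν - q) / 2 - (m : ℝ)) * sobolevNorm q v := by
  refine ⟨fun v => ⟨isHeatSolution_heatSemigroup hn v, fun u hu t ht => ?_⟩, fun v hv t ht => ?_,
    fun T _ => ?_⟩
  · rw [hu.eq_sphereFlow hn ht, heatSemigroup_eq_sphereFlow hn v ht]
  -- Only membership is needed, so the time horizon may be t itself.
  · obtain ⟨C, hC⟩ := exists_sobolevNorm_sphereFlow_le (𝕜 := 𝕜) hn hqν 0 t
    rw [heatSemigroup_eq_sphereFlow hn v ht.le]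
    exact (hC v hv t ht le_rfl).1
  · obtain ⟨C, hC⟩ := exists_sobolevNorm_sphereFlow_le (𝕜 := 𝕜) hn hqν m T
    refine ⟨C, fun v hv t ht htT => ?_⟩
    have heq : ∀ s, 0 < s → heatSemigroup s v = sphereFlow hn v 0 s := fun s hs =>
      heatSemigroup_eq_sphereFlow hn v hs.le
    have hμ : ∀ a : HarmonicIndex 𝕜 n, 0 ≤ eigenvalue n a.1 := fun a => eigenvalue_nonneg hn a.1
    rw [iteratedDeriv_heatFlow (harmonicBasis 𝕜 hn) hμ v heq m ht]
    refine ⟨?_, hC v hv t ht htT⟩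
    exact ((contDiffOn_heatFlow (harmonicBasis 𝕜 hn) hμ v m 0).congr heq).contDiffAt
      (Ioi_mem_nhds ht)
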